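/- Let $l\in\mathbb N$ and $a_0,\dots,a_{l-1}\in\mathbb R$, and consider in the punctured plane, in polar coordinates $(\rho,\varphi)$ with $\rho>0$, the inverted Hopf–Takens system $$\dot\rho=-\rho\Big(\rho^{-2l}+\sum_{j=0}^{l-1}a_j\rho^{-2j}\Big),\qquad \dot\varphi=1 .$$ Suppose that the circle $\rho=a$ is a limit cycle (an isolated periodic orbit) of multiplicity $m$, $1\le m\le l$; that is, $a$ is a zero of order $m$ of the displacement function $x\mapsto P(x)-x$, where $P$ is the Poincaré first return map of the half-line $\varphi=0$ near $a$. Let a *spiral half-trajectory* of the cycle be a half-trajectory $(\rho(t),\varphi(t))$, $t\in[t_0,\infty)$ or $t\in(-\infty,t_0]$, which lies outside the circle ($\rho>a$) or inside it ($\rho<a$), and for which $\rho(t)\to a$ as $t\to\infty$, respectively $t\to-\infty$. Write $f\simeq g$ if $c_1g\le f\le c_2g$ near the limit for some constants $c_1,c_2>0$. There is $\varepsilon>0$ such that, on each side of the cycle, every point at radial distance less than $\varepsilon$ from it lies on a spiral half-trajectory on the same side whose radial distance to the cycle never exceeds that of the point, and such that every half-trajectory which stays on one side at radial distance less than $\varepsilon$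 from the cycle is a spiral half-trajectory. Moreover, every spiral half-trajectory $\Gamma$, outside or inside, has the following properties. (a) If $m=1$, then $\Gamma$ is comparable with the exponential spiral $\rho=a\pm e^{-\beta\varphi}$ ($+$ outside, $-$ inside), i.e. $|\rho-a|\simeq e^{-\beta\varphi}$ as $t\to\pm\infty$ along $\Gamma$; here $\beta\neq0$ is a constant depending only on the system (the coefficients $a_j$) and on the cycle, and not on $\Gamma$. (b) If $m>1$, then $\Gamma$ is comparable with the power spiral $\rho=a\pm|\varphi|^{-1/(m-1)}$, i.e. $|\rho-a|\simeq|\varphi|^{-1/(m-1)}$ as $t\to\pm\infty$ along $\Gamma$. In both cases $\Gamma$, as a subset of the plane, has box dimension (in the sense of Minkowski contents; the upper and lower box dimensions coincide) $$\dim_B\Gamma=2-\frac1m .$$ -/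

import Mathlib

open Set Filter Topology MeasureTheory

noncomputable section

/-! ### Minkowski contents and box dimension -/

/-- Upper `s`-dimensional Minkowski content of `A ⊆ ℝⁿ`: the upper limit, as `ε → 0⁺`, of the volume
of the open `ε`-neighbourhood of `A` divided by `ε ^ (n - s)`. -/
def upperMinkowskiContent {n : ℕ} (s : ℝ) (A : Set (EuclideanSpace ℝ (Fin n))) : ENNReal :=
  limsup (fun ε : ℝ => volume (Metric.thickening ε A) / ENNReal.ofReal (ε ^ ((n : ℝ) - s)))
    (𝓝[>] (0 : ℝ))

/-- Lower `s`-dimensional Minkowski content of `A ⊆ ℝⁿ`. -/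
def lowerMinkowskiContent {n : ℕ} (s : ℝ) (A : Set (EuclideanSpace ℝ (Fin n))) : ENNReal :=
  liminf (fun ε : ℝ => volume (Metric.thickening ε A) / ENNReal.ofReal (ε ^ ((n : ℝ) - s)))
    (𝓝[>] (0 : ℝ))

def upperBoxDim {n : ℕ} (A : Set (EuclideanSpace ℝ (Fin n))) : ℝ :=
  sInf {s : ℝ | 0 < s ∧ upperMinkowskiContent s A = 0}

def lowerBoxDim {n : ℕ} (A : Set (EuclideanSpace ℝ (Fin n))) : ℝ :=
  sInf {s : ℝ | 0 < s ∧ lowerMinkowskiContent s A = 0}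

/-- The nonempty bounded set `A ⊆ ℝⁿ` has box dimension `d`: the upper and the lower box dimension
of `A` are both equal to `d`. -/
def HasBoxDim {n : ℕ} (A : Set (EuclideanSpace ℝ (Fin n))) (d : ℝ) : Prop :=
  A.Nonempty ∧ Bornology.IsBounded A ∧ upperBoxDim A = d ∧ lowerBoxDim A = d

/-- `f ≃ g` along the filter `F`: there are positive constants `c₁, c₂` with `c₁ g ≤ f ≤ c₂ g`
near the limit. -/
def Comparable (F : Filter ℝ) (f g : ℝ → ℝ) : Prop :=
  ∃ c₁ c₂ : ℝ, 0 < c₁ ∧ 0 < c₂ ∧ ∀ᶠ t in F, c₁ * g t ≤ f t ∧ f t ≤ c₂ * g t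

/-! ### The inverted Hopf–Takens system -/

/-- The point of the plane with polar coordinates `(r, θ)`. -/
def polarPoint (r θ : ℝ) : EuclideanSpace ℝ (Fin 2) :=
  !₂[r * Real.cos θ, r * Real.sin θ]

/-- The right-hand side of the radial equation
`ρ' = -ρ (ρ^(-2l) + ∑_{j<l} c_j ρ^(-2j))`. -/
def radialField (l : ℕ) (c : Fin l → ℝ) (ρ : ℝ) : ℝ :=
  -ρ * ((ρ ^ (2 * l))⁻¹ + ∑ j : Fin l, c j * (ρ ^ (2 * (j : ℕ)))⁻¹)

/-- `t ↦ (ρ t, φ t)` solves, on the interval `I`, the inverted Hopf–Takens system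
`ρ' = -ρ (ρ^(-2l) + ∑_{j<l} c_j ρ^(-2j))`, `φ' = 1` in the region `ρ > 0`
(one-sided derivatives at end points of `I`). -/
def IsSolutionOn (l : ℕ) (c : Fin l → ℝ) (I : Set ℝ) (ρ φ : ℝ → ℝ) : Prop :=
  ∀ t ∈ I, 0 < ρ t ∧ HasDerivWithinAt ρ (radialField l c (ρ t)) I t ∧ HasDerivWithinAt φ 1 I t

/-- The circle `ρ = a` is a limit cycle, i.e. an isolated periodic orbit: it is an orbit of the
system, and no other orbit through a point close to the circle is periodic in the plane. -/
def IsLimitCycle (l : ℕ) (c : Fin l → ℝ) (a : ℝ) : Prop :=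
  IsSolutionOn l c univ (fun _ => a) (fun t => t) ∧
  ∀ᶠ x in 𝓝[≠] a, ∀ ρ φ : ℝ → ℝ, IsSolutionOn l c univ ρ φ → ρ 0 = x →
    ¬ ∃ T : ℝ, 0 < T ∧ Function.Periodic (fun t => polarPoint (ρ t) (φ t)) T

/-- Near `a`, `P` is the Poincaré first return map on the half-line `φ = 0` (mod `2π`): the orbit
leaving the half-line at distance `x` from the origin comes back, after one turn, at distance
`P x`. -/
def IsPoincareMapNear (l : ℕ) (c : Fin l → ℝ) (a : ℝ) (P : ℝ → ℝ) : Prop :=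
  ∀ᶠ x in 𝓝 a, ∃ (T : ℝ) (ρ φ : ℝ → ℝ), 0 < T ∧ IsSolutionOn l c (Icc 0 T) ρ φ ∧
    ρ 0 = x ∧ φ 0 = 0 ∧ φ T = 2 * Real.pi ∧ ρ T = P x

/-- The closed orbit `ρ = a` has multiplicity `m ≥ 1`: `a` is a zero of order `m` of the
displacement function `x ↦ P x - x` of the Poincaré map. -/
def HasCycleMultiplicity (l : ℕ) (c : Fin l → ℝ) (a : ℝ) (m : ℕ) : Prop :=
  ∃ P : ℝ → ℝ, IsPoincareMapNear l c a P ∧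
    1 ≤ m ∧ analyticOrderAt (fun x => P x - x) a = (m : ℕ∞)

/-- `I` is a closed half-line of times and `F` is the filter of times going to infinity in it:
either `I = [t₀, ∞)` and `t → +∞`, or `I = (-∞, t₀]` and `t → -∞`. -/
def IsTimeRay (I : Set ℝ) (F : Filter ℝ) : Prop :=
  (∃ t₀ : ℝ, I = Ici t₀ ∧ F = atTop) ∨ (∃ t₀ : ℝ, I = Iic t₀ ∧ F = atBot)

/-- The half-trajectory `t ↦ (ρ t, φ t)`, `t ∈ I`, lies outside (`s = 1`) or inside (`s = -1`) the
circle `ρ = a` and tends to this circle as time goes to `+∞` or to `-∞`. -/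
structure IsSpiralTo (l : ℕ) (c : Fin l → ℝ) (a s : ℝ) (I : Set ℝ) (F : Filter ℝ)
    (ρ φ : ℝ → ℝ) : Prop where
  side : s = 1 ∨ s = -1
  ray : IsTimeRay I F
  sol : IsSolutionOn l c I ρ φ
  pos : ∀ t ∈ I, 0 < s * (ρ t - a)
  tendsto : Tendsto ρ F (𝓝 a)

/-- The subset of the plane traced by the trajectory at times in `I`. -/
def orbitSet (I : Set ℝ) (ρ φ : ℝ → ℝ) : Set (EuclideanSpace ℝ (Fin 2)) :=
  (fun t => polarPoint (ρ t) (φ t)) '' I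

end

/-! ### The order of the radial field at a limit cycle -/

/-! Since the angle moves at unit speed, everything reduces to the scalar equation `ρ' = f(ρ)`, with
`f` analytic near `a` and `f a = 0`. A turn takes time `2π`, so by the mean value theorem the
displacement at `x` is `2π f(y)` for some `y` on the orbit, and a Gronwall argument makes `|y - a|`
and `|x - a|` comparable. Hence `f` vanishes at `a` to order exactly `m`
(`analyticOrderAt_radialField`), and `f x = (x - a) ^ m * g x` with `g a ≠ 0` (`LocalFactor`).

Along a spiral, the distance `v = s (ρ - a)`, as a function of elapsed time, satisfies `v' = Q v ^ m
+ O(v ^ (m + 1))` with `Q ≠ 0`; convergence to the cycle forces `Q < 0` (`exists_decayLaw`).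
Integration gives both rates: for `m = 1`, `log v - Q τ` stays bounded, and for `m > 1`, `v ^ (1 -
m)` lies between two increasing linear functions for large times.

The dimension comes from the area of the `ε`-neighbourhood. At distance `w` from the cycle
consecutive turns are `O(w ^ m)` apart, so the neighbourhood fills a one-sided annulus of width of
order `ε ^ (1/m)` (`DecayLaw.exists_mem_thickening`). Conversely, the part of the spiral up to time
`T` is covered by about `T / ε` balls of radius of order `ε`, and the rest lies in a thin annulus;
optimising `T` bounds the area by a multiple of `ε ^ η` for each `η < 1/m`
(`exists_volume_thickening_le`), which suffices.

Spirals through nearby points come from separation of variables (`exists_solution_of_pos_field`);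
`tendsto_zero_of_pos_field` shows that nearby half-trajectories on one side converge. -/

theorem eq_add_mul_of_hasDerivWithinAt_const {D : Set ℝ} (hD : Convex ℝ D) {φ : ℝ → ℝ} {k : ℝ}
    (h : ∀ x ∈ D, HasDerivWithinAt φ k D x) {x y : ℝ} (hx : x ∈ D) (hy : y ∈ D) :
    φ y = φ x + k * (y - x) := by
  have h1 : ∀ x ∈ D, HasDerivWithinAt (fun t => φ t - k * t) 0 D x := fun x hx => by
    simpa using (h x hx).fun_sub ((hasDerivWithinAt_id x D).const_mul k)
  have h2 := hD.norm_image_sub_le_of_norm_hasDerivWithin_le (C := 0) h1 (by simp) hx hy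
  have h3 : (φ y - k * y) - (φ x - k * x) = 0 := by
    rw [← norm_le_zero_iff]; simpa using h2
  linarith

theorem analyticAt_radialField (l : ℕ) (c : Fin l → ℝ) {a : ℝ} (ha : 0 < a) :
    AnalyticAt ℝ (radialField l c) a := by
  unfold radialField
  have hp : ∀ k : ℕ, AnalyticAt ℝ (fun ρ : ℝ => (ρ ^ k)⁻¹) a := fun k =>
    (analyticAt_id.pow k).inv (pow_ne_zero _ ha.ne')
  refine analyticAt_id.neg.mul ((hp _).add ?_)
  exact Finset.analyticAt_fun_sum _ fun j _ => analyticAt_const.mul (hp _)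

/-- A solution of `ρ' = f(ρ)` which starts close to a zero `a` of a field of linear growth stays
close to `a`, at a distance comparable with the initial one. -/
theorem abs_sub_comparable_of_linear_growth {f ρ : ℝ → ℝ} {a K δ T : ℝ} (hK : 0 ≤ K) (hT : 0 ≤ T)
    (hf : ∀ x, |x - a| ≤ δ → |f x| ≤ K * |x - a|)
    (hρ : ∀ t ∈ Icc 0 T, HasDerivWithinAt ρ (f (ρ t)) (Icc 0 T) t)
    (h0 : ρ 0 ≠ a) (hδ : |ρ 0 - a| * Real.exp ((K + 1) * T) ≤ δ) :
    ∀ t ∈ Icc 0 T, |ρ t - a| ≤ Real.exp ((K + 1) * T) * |ρ 0 - a| ∧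
      |ρ 0 - a| ≤ Real.exp ((K + 1) * T) * |ρ t - a| := by
  have hpos : 0 < |ρ 0 - a| := abs_pos.2 (sub_ne_zero.2 h0)
  have hcont : ContinuousOn ρ (Icc 0 T) := fun t ht => (hρ t ht).continuousWithinAt
  have hexp : ∀ t ∈ Icc 0 T, Real.exp ((K + 1) * t) ≤ Real.exp ((K + 1) * T) := fun t ht =>
    Real.exp_le_exp.2 (mul_le_mul_of_nonneg_left ht.2 (by linarith))
  -- The rate `K + 1` instead of `K` gives the strict inequality that the barrier argument needs
  -- where the two sides meet.
  have hup : ∀ ⦃t⦄, t ∈ Icc 0 T → ‖ρ t - a‖ ≤ |ρ 0 - a| * Real.exp ((K + 1) * t) := by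
    refine image_norm_le_of_norm_deriv_right_lt_deriv_boundary (f := fun t => ρ t - a)
      (f' := fun t => f (ρ t)) (hcont.sub continuousOn_const) ?_ (by simp)
      (B' := fun t => |ρ 0 - a| * (Real.exp ((K + 1) * t) * (K + 1))) ?_ ?_
    · intro t ht
      exact ((hρ t (Ico_subset_Icc_self ht)).mono_of_mem_nhdsWithin
        (Icc_mem_nhdsGE_of_mem ht)).sub_const a
    · intro t
      have h1 : HasDerivAt (fun t : ℝ => (K + 1) * t) (K + 1) t := by
        simpa using (hasDerivAt_id t).const_mul (K + 1)
      exact h1.exp.const_mul _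
    · intro t ht h
      rw [Real.norm_eq_abs] at h ⊢
      have h1 : |ρ t - a| ≤ δ := by
        rw [h]
        exact (mul_le_mul_of_nonneg_left (hexp t (Ico_subset_Icc_self ht)) hpos.le).trans hδ
      have h2 := hf _ h1
      have h3 : 0 < |ρ t - a| := by rw [h]; positivity
      calc |f (ρ t)| ≤ K * |ρ t - a| := h2
        _ < (K + 1) * |ρ t - a| := by linarith
        _ = _ := by rw [h]; ring
  have hle : ∀ t ∈ Icc 0 T, |ρ t - a| ≤ |ρ 0 - a| * Real.exp ((K + 1) * T) := fun t ht =>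
    (hup ht).trans (mul_le_mul_of_nonneg_left (hexp t ht) hpos.le)
  -- For the reverse bound, squaring avoids differentiating the absolute value.
  have hmono : MonotoneOn (fun t => (ρ t - a) ^ 2 * Real.exp (2 * K * t)) (Icc 0 T) := by
    refine monotoneOn_of_hasDerivWithinAt_nonneg (convex_Icc 0 T)
      (f' := fun t => (2 * (ρ t - a) * f (ρ t)) * Real.exp (2 * K * t) +
        (ρ t - a) ^ 2 * (Real.exp (2 * K * t) * (2 * K))) (by fun_prop) ?_ ?_
    · intro t ht
      have h1 := ((hρ t (interior_subset ht)).sub_const a).fun_pow 2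
      have h2 : HasDerivAt (fun t : ℝ => 2 * K * t) (2 * K) t := by
        simpa using (hasDerivAt_id t).const_mul (2 * K)
      have := (h1.mono interior_subset).fun_mul h2.exp.hasDerivWithinAt (s := interior (Icc 0 T))
      simpa using this
    · intro t ht
      have h1 := hf _ ((hle t (interior_subset ht)).trans hδ)
      have h2 : -((ρ t - a) * f (ρ t)) ≤ K * (ρ t - a) ^ 2 := by
        calc -((ρ t - a) * f (ρ t)) ≤ |(ρ t - a) * f (ρ t)| := neg_le_abs _
          _ = |ρ t - a| * |f (ρ t)| := abs_mul _ _
          _ ≤ |ρ t - a| * (K * |ρ t - a|) := mul_le_mul_of_nonneg_left h1 (abs_nonneg _)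
          _ = K * (ρ t - a) ^ 2 := by rw [← sq_abs (ρ t - a)]; ring
      have := mul_nonneg (Real.exp_pos (2 * K * t)).le
        (by linarith : 0 ≤ 2 * ((ρ t - a) * f (ρ t)) + 2 * (K * (ρ t - a) ^ 2))
      linarith
  intro t ht
  refine ⟨by linarith [hle t ht, mul_comm |ρ 0 - a| (Real.exp ((K + 1) * T))], ?_⟩
  have h1 := hmono (left_mem_Icc.2 hT) ht ht.1
  simp only [mul_zero, Real.exp_zero, mul_one] at h1
  have h2 : (ρ 0 - a) ^ 2 ≤ (Real.exp (K * t) * |ρ t - a|) ^ 2 := by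
    have e : Real.exp (2 * K * t) = Real.exp (K * t) ^ 2 := by
      rw [← Real.exp_nat_mul]; congr 1; push_cast; ring
    rw [mul_pow, sq_abs, ← e]
    linarith
  have h3 : |ρ 0 - a| ≤ Real.exp (K * t) * |ρ t - a| :=
    abs_le_of_sq_le_sq h2 (by positivity)
  refine h3.trans (mul_le_mul_of_nonneg_right ?_ (abs_nonneg _))
  exact Real.exp_le_exp.2 (by nlinarith [ht.1, ht.2])

/-- If `k < m`, division by `r ^ k` leaves `1 ≤ C * r ^ (m - k)`, which fails as `r → 0`. Used in
both directions, it identifies the two orders of vanishing. -/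
theorem le_of_eventually_pow_le {k m : ℕ} {C : ℝ}
    (h : ∀ᶠ r in 𝓝[>] (0 : ℝ), r ^ k ≤ C * r ^ m) : m ≤ k := by
  by_contra! hk
  obtain ⟨d, rfl⟩ := Nat.exists_eq_add_of_lt hk
  have h1 : ∀ᶠ r in 𝓝[>] (0 : ℝ), 1 ≤ C * r ^ (d + 1) := by
    filter_upwards [h, self_mem_nhdsWithin] with r hr h0
    have h0 : (0 : ℝ) < r ^ k := pow_pos h0 k
    have : r ^ k * 1 ≤ r ^ k * (C * r ^ (d + 1)) := by
      calc r ^ k * 1 ≤ C * r ^ (k + d + 1) := by simpa using hr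
        _ = _ := by ring
    exact le_of_mul_le_mul_left this h0
  have h2 : Tendsto (fun r : ℝ => C * r ^ (d + 1)) (𝓝[>] 0) (𝓝 0) := by
    have : Continuous fun r : ℝ => C * r ^ (d + 1) := by fun_prop
    simpa using (this.tendsto 0).mono_left nhdsWithin_le_nhds
  have h3 := ge_of_tendsto h2 h1
  linarith

/-- If `f` has a zero of order `k` at `a`, then `|f x|` is comparable with `|x - a| ^ k`. -/
theorem exists_pow_bounds_of_analyticOrderAt_eq {f : ℝ → ℝ} {a : ℝ} {k : ℕ} (hf : AnalyticAt ℝ f a)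
    (hk : analyticOrderAt f a = k) : ∃ c C : ℝ, 0 < c ∧ 0 < C ∧
      ∀ᶠ x in 𝓝 a, c * |x - a| ^ k ≤ |f x| ∧ |f x| ≤ C * |x - a| ^ k := by
  obtain ⟨g, hg, hg0, hfg⟩ := hf.analyticOrderAt_eq_natCast.1 hk
  have h0 : 0 < |g a| := abs_pos.2 hg0
  have hc : Tendsto (fun x => |g x|) (𝓝 a) (𝓝 |g a|) := hg.continuousAt.tendsto.abs
  refine ⟨|g a| / 2, 2 * |g a|, by positivity, by positivity, ?_⟩
  filter_upwards [hfg, hc.eventually (lt_mem_nhds (by linarith : |g a| / 2 < |g a|)),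
    hc.eventually (gt_mem_nhds (by linarith : |g a| < 2 * |g a|))] with x hx h1 h2
  rw [hx, smul_eq_mul, abs_mul, abs_pow, mul_comm (|x - a| ^ k)]
  exact ⟨mul_le_mul_of_nonneg_right h1.le (by positivity),
    mul_le_mul_of_nonneg_right h2.le (by positivity)⟩

/-- The displacement of the Poincaré map at `x` is `2π` times the radial field at a point whose
distance to `a` is comparable with that of `x`. -/
theorem eventually_displacement_eq {l : ℕ} {c : Fin l → ℝ} {a : ℝ} {P : ℝ → ℝ} (ha : 0 < a)
    (hfa : radialField l c a = 0) (hP : IsPoincareMapNear l c a P) :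
    ∃ C : ℝ, 0 < C ∧ ∀ᶠ x in 𝓝[≠] a, ∃ y, |y - a| ≤ C * |x - a| ∧ |x - a| ≤ C * |y - a| ∧
      P x - x = 2 * Real.pi * radialField l c y := by
  have hO := (analyticAt_radialField l c ha).differentiableAt.isBigO_sub
  rw [hfa] at hO
  obtain ⟨K, hK, hO⟩ := hO.exists_nonneg
  obtain ⟨δ, hδ, hball⟩ := Metric.eventually_nhds_iff.1 hO.bound
  have hf : ∀ x, |x - a| ≤ δ / 2 → |radialField l c x| ≤ K * |x - a| := fun x hx => by
    have := hball (y := x) (by rw [Real.dist_eq]; linarith)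
    simpa using this
  set E := Real.exp ((K + 1) * (2 * Real.pi)) with hE
  have hE0 : 0 < E := Real.exp_pos _
  have hpi := Real.two_pi_pos
  refine ⟨E, hE0, ?_⟩
  have hsmall : ∀ᶠ x in 𝓝 a, |x - a| * E ≤ δ / 2 := by
    have : Tendsto (fun x => |x - a| * E) (𝓝 a) (𝓝 0) := by
      have : Continuous fun x => |x - a| * E := by fun_prop
      simpa using this.tendsto a
    exact (this.eventually (gt_mem_nhds (half_pos hδ))).mono fun _ h => h.le
  filter_upwards [hP.filter_mono nhdsWithin_le_nhds, hsmall.filter_mono nhdsWithin_le_nhds,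
    self_mem_nhdsWithin] with x ⟨T, ρ, φ, hT, hsol, h0, hφ0, hφT, hρT⟩ hx hxa
  have hTe : T = 2 * Real.pi := by
    have := eq_add_mul_of_hasDerivWithinAt_const (convex_Icc 0 T) (fun t ht => (hsol t ht).2.2)
      (left_mem_Icc.2 hT.le) (right_mem_Icc.2 hT.le)
    linarith
  subst hTe
  have hbd := abs_sub_comparable_of_linear_growth (a := a) hK hT.le hf
    (fun t ht => (hsol t ht).2.1) (by rw [h0]; exact hxa) (by rw [h0]; exact hx)
  -- The point `y` is `ρ ξ`, where the radial speed equals its mean over one turn.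
  obtain ⟨ξ, hξ, hs⟩ := exists_hasDerivAt_eq_slope ρ (fun t => radialField l c (ρ t)) hT
    (fun t ht => (hsol t ht).2.1.continuousWithinAt)
    (fun t ht => (hsol t (Ioo_subset_Icc_self ht)).2.1.hasDerivAt (Icc_mem_nhds ht.1 ht.2))
  have hb := hbd ξ (Ioo_subset_Icc_self hξ)
  rw [h0] at hb
  refine ⟨ρ ξ, hb.1, hb.2, ?_⟩
  rw [hs, hρT, h0, sub_zero]
  field_simp

/-- The order of the radial field at a cycle is the multiplicity of the cycle. -/
theorem analyticOrderAt_radialField {l m : ℕ} {c : Fin l → ℝ} {a : ℝ} (ha : 0 < a)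
    (hfa : radialField l c a = 0) (hmult : HasCycleMultiplicity l c a m) :
    analyticOrderAt (radialField l c) a = m := by
  obtain ⟨P, hP, hm, hord⟩ := hmult
  have hfan := analyticAt_radialField l c ha
  obtain ⟨C, hC, hdisp⟩ := eventually_displacement_eq ha hfa hP
  -- A function that is not analytic at `a` has order `0` by convention, which `1 ≤ m` excludes.
  have hDan : AnalyticAt ℝ (fun x => P x - x) a := by
    by_contra h
    rw [analyticOrderAt_of_not_analyticAt h] at hord
    have : m = 0 := by exact_mod_cast hord.symm
    omega
  have hsmall : ∀ {p : ℝ → Prop}, (∀ᶠ y in 𝓝 a, p y) →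
      ∀ᶠ x in 𝓝 a, ∀ y, |y - a| ≤ C * |x - a| → p y := fun {p} hp => by
    obtain ⟨δ, hδ, hball⟩ := Metric.eventually_nhds_iff.1 hp
    have : Tendsto (fun x => C * |x - a|) (𝓝 a) (𝓝 0) := by
      have : Continuous fun x => C * |x - a| := by fun_prop
      simpa using this.tendsto a
    filter_upwards [this.eventually (gt_mem_nhds hδ)] with x hx y hy
    exact hball (by rw [Real.dist_eq]; linarith)
  obtain ⟨d, D, hd, hD, hDb⟩ := exists_pow_bounds_of_analyticOrderAt_eq hDan hord
  have hpi := Real.two_pi_pos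
  have hright : Tendsto (fun r : ℝ => a + r) (𝓝[>] 0) (𝓝[≠] a) := by
    refine tendsto_nhdsWithin_iff.2 ⟨?_, ?_⟩
    · have : Continuous fun r : ℝ => a + r := by fun_prop
      simpa using (this.tendsto 0).mono_left nhdsWithin_le_nhds
    · filter_upwards [self_mem_nhdsWithin] with r hr
      have : (0 : ℝ) < r := hr
      simpa using this.ne'
  cases hk : analyticOrderAt (radialField l c) a with
  | top =>
    exfalso
    -- A field vanishing near `a` would make the displacement vanish there, against its finite
    -- order.
    have h1 := hsmall (analyticOrderAt_eq_top.1 hk)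
    have h2 : ∀ᶠ x in 𝓝[≠] a, False := by
      filter_upwards [hdisp, h1.filter_mono nhdsWithin_le_nhds, hDb.filter_mono nhdsWithin_le_nhds,
        self_mem_nhdsWithin] with x ⟨y, hy, _, hxy⟩ h1 h2 hxa
      have h3 : 0 < |x - a| := abs_pos.2 (sub_ne_zero.2 hxa)
      have h4 := h2.1
      rw [hxy, h1 y hy] at h4
      simp only [mul_zero, abs_zero] at h4
      have : 0 < d * |x - a| ^ m := by positivity
      linarith
    obtain ⟨_, h⟩ := h2.exists
    exact h
  | coe k =>
    obtain ⟨b, B, hb, hB, hfb⟩ := exists_pow_bounds_of_analyticOrderAt_eq hfan hk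
    have key : ∀ᶠ x in 𝓝[≠] a, |x - a| ^ m ≤ (2 * Real.pi * B * C ^ k / d) * |x - a| ^ k ∧
        |x - a| ^ k ≤ (C ^ k * D / (2 * Real.pi * b)) * |x - a| ^ m := by
      filter_upwards [hdisp, (hsmall hfb).filter_mono nhdsWithin_le_nhds,
        hDb.filter_mono nhdsWithin_le_nhds] with x ⟨y, hy1, hy2, hxy⟩ h1 h2
      have h1 := h1 y hy1
      rw [hxy, abs_mul, abs_of_pos hpi] at h2
      have e1 : |y - a| ^ k ≤ C ^ k * |x - a| ^ k := by
        rw [← mul_pow]; exact pow_le_pow_left₀ (abs_nonneg _) hy1 k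
      have e2 : |x - a| ^ k ≤ C ^ k * |y - a| ^ k := by
        rw [← mul_pow]; exact pow_le_pow_left₀ (abs_nonneg _) hy2 k
      constructor
      · rw [div_mul_eq_mul_div, le_div_iff₀ hd]
        calc |x - a| ^ m * d = d * |x - a| ^ m := mul_comm _ _
          _ ≤ 2 * Real.pi * |radialField l c y| := h2.1
          _ ≤ 2 * Real.pi * (B * (C ^ k * |x - a| ^ k)) := by
              refine mul_le_mul_of_nonneg_left (h1.2.trans ?_) hpi.le
              exact mul_le_mul_of_nonneg_left e1 hB.le
          _ = _ := by ring
      · rw [div_mul_eq_mul_div, le_div_iff₀ (by positivity)]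
        calc |x - a| ^ k * (2 * Real.pi * b) ≤ C ^ k * |y - a| ^ k * (2 * Real.pi * b) :=
              mul_le_mul_of_nonneg_right e2 (by positivity)
          _ = C ^ k * (2 * Real.pi * (b * |y - a| ^ k)) := by ring
          _ ≤ C ^ k * (2 * Real.pi * |radialField l c y|) := by
              refine mul_le_mul_of_nonneg_left ?_ (by positivity)
              exact mul_le_mul_of_nonneg_left h1.1 hpi.le
          _ ≤ C ^ k * (D * |x - a| ^ m) := mul_le_mul_of_nonneg_left h2.2 (by positivity)
          _ = _ := by ring
    have key' := hright.eventually key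
    have hr : ∀ᶠ r in 𝓝[>] (0 : ℝ), |a + r - a| = r := by
      filter_upwards [self_mem_nhdsWithin] with r hr
      rw [add_sub_cancel_left, abs_of_pos hr]
    have i1 : k ≤ m := le_of_eventually_pow_le (C := 2 * Real.pi * B * C ^ k / d) (by
      filter_upwards [key', hr] with r h1 h2
      rw [h2] at h1; exact h1.1)
    have i2 : m ≤ k := le_of_eventually_pow_le (C := C ^ k * D / (2 * Real.pi * b)) (by
      filter_upwards [key', hr] with r h1 h2
      rw [h2] at h1; exact h1.2)
    rw [le_antisymm i1 i2]

theorem IsLimitCycle.pos_and_radialField_eq_zero {l : ℕ} {c : Fin l → ℝ} {a : ℝ}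
    (h : IsLimitCycle l c a) : 0 < a ∧ radialField l c a = 0 := by
  have h1 := h.1 0 (mem_univ _)
  refine ⟨h1.1, ?_⟩
  have h2 := h1.2.1
  rw [hasDerivWithinAt_univ] at h2
  exact h2.unique (hasDerivAt_const 0 a)

/-! ### Positive solutions of `v' = -q` with `q ≃ v ^ m` -/

theorem monotoneOn_Ici_of_hasDerivAt_nonneg {T : ℝ} {y y' : ℝ → ℝ}
    (h : ∀ τ, T ≤ τ → HasDerivAt y (y' τ) τ) (h0 : ∀ τ, T ≤ τ → 0 ≤ y' τ) :
    MonotoneOn y (Ici T) :=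
  monotoneOn_of_hasDerivWithinAt_nonneg (convex_Ici T)
    (fun τ hτ => (h τ hτ).continuousAt.continuousWithinAt)
    (fun τ hτ => (h τ (interior_subset hτ)).hasDerivWithinAt)
    (fun τ hτ => h0 τ (interior_subset hτ))

theorem antitoneOn_Ici_of_hasDerivAt_nonpos {T : ℝ} {y y' : ℝ → ℝ}
    (h : ∀ τ, T ≤ τ → HasDerivAt y (y' τ) τ) (h0 : ∀ τ, T ≤ τ → y' τ ≤ 0) :
    AntitoneOn y (Ici T) := by
  have := monotoneOn_Ici_of_hasDerivAt_nonneg (fun τ hτ => (h τ hτ).fun_neg)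
    (fun τ hτ => neg_nonneg.2 (h0 τ hτ))
  intro x hx y hy hxy
  linarith [this hx hy hxy]

/-- On `[T, ∞)` the positive function `v` tends to `0` and decreases at the rate `q`, where `q` lies
between `c₁ v ^ m` and `c₂ v ^ m`. -/
structure DecayLaw (m : ℕ) (v q : ℝ → ℝ) (T c₁ c₂ : ℝ) : Prop where
  c₁_pos : 0 < c₁
  v_pos : ∀ τ, T ≤ τ → 0 < v τ
  hasDerivAt : ∀ τ, T ≤ τ → HasDerivAt v (-q τ) τ
  le_rate : ∀ τ, T ≤ τ → c₁ * v τ ^ m ≤ q τ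
  rate_le : ∀ τ, T ≤ τ → q τ ≤ c₂ * v τ ^ m
  tendsto : Tendsto v atTop (𝓝 0)

namespace DecayLaw

variable {m : ℕ} {v q : ℝ → ℝ} {T c₁ c₂ : ℝ}

theorem rate_nonneg (h : DecayLaw m v q T c₁ c₂) {τ : ℝ} (hτ : T ≤ τ) : 0 ≤ q τ :=
  (mul_nonneg h.c₁_pos.le (pow_nonneg (h.v_pos τ hτ).le m)).trans (h.le_rate τ hτ)

theorem c₂_pos (h : DecayLaw m v q T c₁ c₂) : 0 < c₂ :=
  h.c₁_pos.trans_le (le_of_mul_le_mul_right ((h.le_rate T le_rfl).trans (h.rate_le T le_rfl))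
    (pow_pos (h.v_pos T le_rfl) m))

theorem antitoneOn (h : DecayLaw m v q T c₁ c₂) : AntitoneOn v (Ici T) :=
  antitoneOn_Ici_of_hasDerivAt_nonpos h.hasDerivAt fun _ hτ => neg_nonpos.2 (h.rate_nonneg hτ)

theorem mono (h : DecayLaw m v q T c₁ c₂) {T' : ℝ} (hT : T ≤ T') : DecayLaw m v q T' c₁ c₂ where
  c₁_pos := h.c₁_pos
  v_pos τ hτ := h.v_pos τ (hT.trans hτ)
  hasDerivAt τ hτ := h.hasDerivAt τ (hT.trans hτ)
  le_rate τ hτ := h.le_rate τ (hT.trans hτ)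
  rate_le τ hτ := h.rate_le τ (hT.trans hτ)
  tendsto := h.tendsto

/-- Power decay for `m = k + 2`. -/
theorem comparable_rpow {k : ℕ} (h : DecayLaw (k + 2) v q T c₁ c₂) :
    Comparable atTop v fun τ => τ ^ (-1 / ((k : ℝ) + 1)) := by
  -- The derivative of `v ^ (1 - m)` lies between positive constants.
  have hd : ∀ τ, T ≤ τ → HasDerivAt (fun τ => (v τ ^ (k + 1))⁻¹)
      ((k + 1) * (q τ / v τ ^ (k + 2))) τ := by
    intro τ hτ
    have hv := h.v_pos τ hτ
    refine (((h.hasDerivAt τ hτ).fun_pow (k + 1)).fun_inv (pow_pos hv _).ne').congr_deriv ?_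
    rw [Nat.add_sub_cancel, Nat.cast_add, Nat.cast_one]
    field_simp
    ring
  have hc₁ := h.c₁_pos
  have hc₂ := h.c₂_pos
  have h1 := monotoneOn_Ici_of_hasDerivAt_nonneg
    (fun τ hτ => (hd τ hτ).fun_sub ((hasDerivAt_id τ).const_mul ((k + 1) * c₁)))
    (fun τ hτ => by
      have : c₁ ≤ q τ / v τ ^ (k + 2) :=
        (le_div_iff₀ (pow_pos (h.v_pos τ hτ) _)).2 (h.le_rate τ hτ)
      have : (k + 1 : ℝ) * c₁ ≤ (k + 1) * (q τ / v τ ^ (k + 2)) := by gcongr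
      linarith)
  have h2 := antitoneOn_Ici_of_hasDerivAt_nonpos
    (fun τ hτ => (hd τ hτ).fun_sub ((hasDerivAt_id τ).const_mul ((k + 1) * c₂)))
    (fun τ hτ => by
      have : q τ / v τ ^ (k + 2) ≤ c₂ :=
        (div_le_iff₀ (pow_pos (h.v_pos τ hτ) _)).2 (h.rate_le τ hτ)
      have : (k + 1 : ℝ) * (q τ / v τ ^ (k + 2)) ≤ (k + 1) * c₂ := by gcongr
      linarith)
  set A := (k + 1 : ℝ) * c₁ with hA
  set B := (k + 1 : ℝ) * c₂ with hB
  have hA0 : 0 < A := by positivity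
  have hB0 : 0 < B := by positivity
  set Y := (v T ^ (k + 1))⁻¹ with hY
  have hY0 : 0 < Y := inv_pos.2 (pow_pos (h.v_pos T le_rfl) _)
  have hk : (0 : ℝ) < k + 1 := by positivity
  set p := -1 / ((k : ℝ) + 1) with hp
  have hp0 : p ≤ 0 := by rw [hp]; exact div_nonpos_of_nonpos_of_nonneg (by norm_num) hk.le
  refine ⟨(2 * B) ^ p, (A / 2) ^ p, by positivity, by positivity, ?_⟩
  -- The last two thresholds absorb the initial data: `A (τ - T) ≥ A τ / 2` and `Y + B (τ - T) ≤ 2 B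
  -- τ`.
  filter_upwards [eventually_ge_atTop T, eventually_gt_atTop 0, eventually_ge_atTop (2 * T),
    eventually_ge_atTop ((Y - B * T) / B)] with τ hτ hτ0 hτ2 hτ3
  have e1 := h1 self_mem_Ici hτ hτ
  have e2 := h2 self_mem_Ici hτ hτ
  simp only [id] at e1 e2
  have hv := h.v_pos τ hτ
  have ev : v τ = ((v τ ^ (k + 1))⁻¹) ^ p := by
    rw [← Real.rpow_natCast, ← Real.rpow_neg hv.le, ← Real.rpow_mul hv.le, hp]
    have : -((k + 1 : ℕ) : ℝ) * (-1 / ((k : ℝ) + 1)) = 1 := by push_cast; field_simp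
    rw [this, Real.rpow_one]
  rw [div_le_iff₀ hB0] at hτ3
  have e3 : (v τ ^ (k + 1))⁻¹ ≤ 2 * B * τ := by nlinarith
  have e4 : A / 2 * τ ≤ (v τ ^ (k + 1))⁻¹ := by nlinarith
  have e5 : 0 < (v τ ^ (k + 1))⁻¹ := inv_pos.2 (pow_pos hv _)
  rw [← Real.mul_rpow (by positivity) hτ0.le, ← Real.mul_rpow (by positivity) hτ0.le, ev]
  exact ⟨Real.rpow_le_rpow_of_nonpos e5 e3 hp0, Real.rpow_le_rpow_of_nonpos (by positivity) e4 hp0⟩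

/-- Exponential decay for `m = 1`. -/
theorem comparable_exp {b M : ℝ} (h : DecayLaw 1 v q T c₁ c₂)
    (hM : ∀ τ, T ≤ τ → |q τ - b * v τ| ≤ M * v τ ^ 2) :
    Comparable atTop v fun τ => Real.exp (-b * τ) := by
  have hc₁ := h.c₁_pos
  have hd : ∀ τ, T ≤ τ → HasDerivAt (fun τ => Real.log (v τ) + b * τ) (-q τ / v τ + b) τ :=
    fun τ hτ => by
      simpa using ((h.hasDerivAt τ hτ).log (h.v_pos τ hτ).ne').fun_add
        ((hasDerivAt_id τ).const_mul b)
  have hM0 : 0 ≤ M := by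
    have := (abs_nonneg _).trans (hM T le_rfl)
    exact nonneg_of_mul_nonneg_left this (pow_pos (h.v_pos T le_rfl) 2)
  -- The error is at most `M v ≤ (M / c₁) q = -(M / c₁) v'`, so adding or subtracting `(M / c₁) v`,
  -- a bounded function, makes `log v + b τ` monotone.
  have hb : ∀ τ, T ≤ τ → |(-q τ / v τ + b)| ≤ M / c₁ * q τ := fun τ hτ => by
    have hv := h.v_pos τ hτ
    have e : -q τ / v τ + b = -(q τ - b * v τ) / v τ := by field_simp; ring
    rw [e, abs_div, abs_neg, abs_of_pos hv, div_le_iff₀ hv]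
    refine (hM τ hτ).trans ?_
    have := h.le_rate τ hτ
    rw [pow_one] at this
    calc M * v τ ^ 2 = M / c₁ * (c₁ * v τ) * v τ := by field_simp
      _ ≤ M / c₁ * q τ * v τ := by gcongr
  have h1 := antitoneOn_Ici_of_hasDerivAt_nonpos
    (fun τ hτ => (hd τ hτ).fun_add ((h.hasDerivAt τ hτ).const_mul (M / c₁)))
    (fun τ hτ => by linarith [(abs_le.1 (hb τ hτ)).2])
  have h2 := monotoneOn_Ici_of_hasDerivAt_nonneg
    (fun τ hτ => (hd τ hτ).fun_sub ((h.hasDerivAt τ hτ).const_mul (M / c₁)))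
    (fun τ hτ => by linarith [(abs_le.1 (hb τ hτ)).1])
  set N := Real.log (v T) + b * T with hN
  refine ⟨Real.exp (N - M / c₁ * v T), Real.exp (N + M / c₁ * v T), Real.exp_pos _,
    Real.exp_pos _, ?_⟩
  filter_upwards [eventually_ge_atTop T] with τ hτ
  have e1 := h1 self_mem_Ici hτ hτ
  have e2 := h2 self_mem_Ici hτ hτ
  simp only at e1 e2
  have hv := h.v_pos τ hτ
  have hv' : 0 ≤ M / c₁ * v τ := by positivity
  rw [← Real.exp_add, ← Real.exp_add]
  constructor
  · rw [← Real.le_log_iff_exp_le hv]; linarith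
  · rw [← Real.log_le_iff_le_exp hv]; linarith

/-- The values of `v` on an interval of length `d` are comparable. -/
theorem le_exp_mul (h : DecayLaw m v q T c₁ c₂) (hm : 1 ≤ m) (hv1 : ∀ τ, T ≤ τ → v τ ≤ 1)
    {τ d : ℝ} (hτ : T ≤ τ) (hd : 0 ≤ d) : v τ ≤ Real.exp (c₂ * d) * v (τ + d) := by
  -- Since `v ≤ 1`, the rate is at most `c₂ v`, so `v * exp (c₂ τ)` is nondecreasing.
  have hdv : ∀ τ, T ≤ τ → HasDerivAt (fun τ => v τ * Real.exp (c₂ * τ))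
      ((c₂ * v τ - q τ) * Real.exp (c₂ * τ)) τ := fun τ hτ => by
    have h1 : HasDerivAt (fun t : ℝ => c₂ * t) c₂ τ := by
      simpa using (hasDerivAt_id τ).const_mul c₂
    exact ((h.hasDerivAt τ hτ).fun_mul h1.exp).congr_deriv (by ring)
  have h1 := monotoneOn_Ici_of_hasDerivAt_nonneg hdv (fun τ hτ => by
    refine mul_nonneg (sub_nonneg.2 ((h.rate_le τ hτ).trans ?_)) (Real.exp_pos _).le
    refine mul_le_mul_of_nonneg_left ?_ h.c₂_pos.le
    exact pow_le_of_le_one (h.v_pos τ hτ).le (hv1 τ hτ) (by omega))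
  have h2 := h1 (mem_Ici.2 hτ) (mem_Ici.2 (by linarith : T ≤ τ + d)) (by linarith)
  have e : Real.exp (c₂ * (τ + d)) = Real.exp (c₂ * d) * Real.exp (c₂ * τ) := by
    rw [← Real.exp_add]; ring_nf
  simp only [e] at h2
  refine le_of_mul_le_mul_right (h2.trans_eq ?_) (Real.exp_pos (c₂ * τ))
  ring

/-- Because `v` decreases, its speed after `τ` is at most `c₂ v(τ) ^ m`. With `d = 2π` this bounds
the radial gap between consecutive turns. -/
theorem sub_le (h : DecayLaw m v q T c₁ c₂) {τ d : ℝ} (hτ : T ≤ τ) (hd : 0 ≤ d) :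
    v τ - v (τ + d) ≤ d * (c₂ * v τ ^ m) := by
  have h1 := (convex_Icc τ (τ + d)).norm_image_sub_le_of_norm_hasDerivWithin_le
    (f := v) (f' := fun t => -q t) (C := c₂ * v τ ^ m)
    (fun t ht => (h.hasDerivAt t (hτ.trans ht.1)).hasDerivWithinAt)
    (fun t ht => by
      have hTt := hτ.trans ht.1
      rw [norm_neg, Real.norm_eq_abs, abs_of_nonneg (h.rate_nonneg hTt)]
      refine (h.rate_le t hTt).trans (mul_le_mul_of_nonneg_left ?_ h.c₂_pos.le)
      exact pow_le_pow_left₀ (h.v_pos t hTt).le (h.antitoneOn hτ hTt ht.1) m)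
    (left_mem_Icc.2 (by linarith)) (right_mem_Icc.2 (by linarith))
  rw [Real.norm_eq_abs, Real.norm_eq_abs, add_sub_cancel_left, abs_of_nonneg hd] at h1
  linarith [neg_le_abs (v (τ + d) - v τ)]

end DecayLaw

/-- A positive function tending to `0` and satisfying `v' = Q v ^ m + O(v ^ (m + 1))` with `Q ≠ 0`
is decreasing, i.e. `Q < 0`, and obeys a decay law. -/
theorem exists_decayLaw {m : ℕ} {v w : ℝ → ℝ} {Q M T₀ : ℝ} (hQ : Q ≠ 0)
    (hv : ∀ τ, T₀ ≤ τ → 0 < v τ) (hd : ∀ τ, T₀ ≤ τ → HasDerivAt v (w τ) τ)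
    (hlim : Tendsto v atTop (𝓝 0))
    (hw : ∀ᶠ τ in atTop, |w τ - Q * v τ ^ m| ≤ M * v τ ^ (m + 1)) :
    Q < 0 ∧ ∃ T c₁ c₂, T₀ ≤ T ∧ DecayLaw m v (fun τ => -w τ) T c₁ c₂ ∧
      ∀ τ, T ≤ τ → |w τ - Q * v τ ^ m| ≤ M * v τ ^ (m + 1) := by
  have h1 : ∀ᶠ τ in atTop, M * v τ ≤ |Q| / 2 := by
    have : Tendsto (fun τ => M * v τ) atTop (𝓝 0) := by simpa using hlim.const_mul M
    exact (this.eventually (gt_mem_nhds (by positivity : 0 < |Q| / 2))).mono fun _ h => h.le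
  obtain ⟨T, hT⟩ := ((h1.and hw).and (eventually_ge_atTop T₀)).exists_forall_of_atTop
  have hT0 : T₀ ≤ T := (hT T le_rfl).2
  have hb : ∀ τ, T ≤ τ → |w τ - Q * v τ ^ m| ≤ |Q| / 2 * v τ ^ m := fun τ hτ => by
    obtain ⟨⟨e1, e2⟩, -⟩ := hT τ hτ
    have := pow_pos (hv τ (hT0.trans hτ)) m
    calc _ ≤ M * v τ ^ (m + 1) := e2
      _ = M * v τ * v τ ^ m := by ring
      _ ≤ _ := by gcongr
  have hneg : Q < 0 := by
    -- With `Q > 0` the positive function `v` would be nondecreasing and could not tend to `0`.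
    by_contra! hQ0
    have hmono := monotoneOn_Ici_of_hasDerivAt_nonneg (fun τ hτ => hd τ (hT0.trans hτ))
      (fun τ hτ => by
        have e := (abs_le.1 (hb τ hτ)).1
        rw [abs_of_nonneg hQ0] at e
        have : 0 ≤ Q / 2 * v τ ^ m :=
          mul_nonneg (by positivity) (pow_pos (hv τ (hT0.trans hτ)) m).le
        linarith)
    have : v T ≤ 0 := ge_of_tendsto hlim (by
      filter_upwards [eventually_ge_atTop T] with τ hτ
      exact hmono self_mem_Ici hτ hτ)
    exact absurd (hv T hT0) (not_lt.2 this)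
  refine ⟨hneg, T, -Q / 2, -(3 * Q) / 2, hT0, ⟨by linarith, fun τ hτ => hv τ (hT0.trans hτ),
    fun τ hτ => by simpa using hd τ (hT0.trans hτ), fun τ hτ => ?_, fun τ hτ => ?_, hlim⟩,
    fun τ hτ => (hT τ hτ).1.2⟩
  · have e := (abs_le.1 (hb τ hτ)).2
    rw [abs_of_neg hneg] at e
    linarith
  · have e := (abs_le.1 (hb τ hτ)).1
    rw [abs_of_neg hneg] at e
    linarith

/-! ### Comparability, and passage from elapsed time to angle -/

theorem Comparable.trans {F : Filter ℝ} {f g h : ℝ → ℝ} (hfg : Comparable F f g)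
    (hgh : Comparable F g h) : Comparable F f h := by
  obtain ⟨c₁, c₂, hc₁, hc₂, h1⟩ := hfg
  obtain ⟨d₁, d₂, hd₁, hd₂, h2⟩ := hgh
  refine ⟨c₁ * d₁, c₂ * d₂, by positivity, by positivity, ?_⟩
  filter_upwards [h1, h2] with t ht1 ht2
  constructor
  · calc c₁ * d₁ * h t = c₁ * (d₁ * h t) := by ring
      _ ≤ c₁ * g t := mul_le_mul_of_nonneg_left ht2.1 hc₁.le
      _ ≤ f t := ht1.1
  · calc f t ≤ c₂ * g t := ht1.2
      _ ≤ c₂ * (d₂ * h t) := mul_le_mul_of_nonneg_left ht2.2 hc₂.le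
      _ = c₂ * d₂ * h t := by ring

/-- The angle along a ray is `φ₀ + σ τ`, and its absolute value lies between `τ / 2` and `2 τ` once
`τ ≥ 2 |φ₀|`. -/
theorem comparable_rpow_abs_affine {p σ φ₀ : ℝ} (hp : p ≤ 0) (hσ : σ = 1 ∨ σ = -1) :
    Comparable atTop (fun τ => τ ^ p) fun τ => |φ₀ + σ * τ| ^ p := by
  refine ⟨(1 / 2) ^ (-p), 2 ^ (-p), by positivity, by positivity, ?_⟩
  filter_upwards [eventually_gt_atTop 0, eventually_ge_atTop (2 * |φ₀|)] with τ h0 h1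
  have hστ : |σ * τ| = τ := by
    rcases hσ with rfl | rfl <;> simp [abs_of_pos h0]
  have e1 : |φ₀ + σ * τ| ≤ 2 * τ := by
    have := abs_add_le φ₀ (σ * τ); rw [hστ] at this; linarith [abs_nonneg φ₀]
  have e2 : τ / 2 ≤ |φ₀ + σ * τ| := by
    have := abs_sub_abs_le_abs_sub (σ * τ) (-φ₀)
    rw [hστ, abs_neg, sub_neg_eq_add, add_comm (σ * τ)] at this; linarith
  have hx : 0 < |φ₀ + σ * τ| := by linarith
  set x := |φ₀ + σ * τ| with hxd
  have k1 : (1 / 2 : ℝ) ^ (-p) * x ^ p = (2 * x) ^ p := by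
    rw [Real.mul_rpow (by norm_num) hx.le, one_div, Real.inv_rpow (by norm_num),
      Real.rpow_neg (by norm_num), inv_inv]
  have k2 : (2 : ℝ) ^ (-p) * x ^ p = (x / 2) ^ p := by
    rw [Real.div_rpow hx.le (by norm_num), Real.rpow_neg (by norm_num)]; field_simp
  rw [k1, k2]
  exact ⟨Real.rpow_le_rpow_of_nonpos h0 (by linarith) hp,
    Real.rpow_le_rpow_of_nonpos (by linarith) (by linarith) hp⟩

/-! ### Polar coordinates and areas -/

theorem polarPoint_sub (r r' θ : ℝ) : polarPoint r θ - polarPoint r' θ = polarPoint (r - r') θ := by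
  ext i; fin_cases i <;> simp [polarPoint] <;> ring

theorem norm_polarPoint (r θ : ℝ) : ‖polarPoint r θ‖ = |r| := by
  rw [EuclideanSpace.norm_eq, ← Real.sqrt_sq_eq_abs]
  congr 1
  simp only [polarPoint, Fin.sum_univ_two, Real.norm_eq_abs, sq_abs]
  simp only [Matrix.cons_val_zero, Matrix.cons_val_one]
  nlinarith [Real.sin_sq_add_cos_sq θ]

theorem dist_polarPoint_same_angle (r r' θ : ℝ) :
    dist (polarPoint r θ) (polarPoint r' θ) = |r - r'| := by
  rw [dist_eq_norm, polarPoint_sub, norm_polarPoint]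

theorem polarPoint_add_int_mul_two_pi (r θ : ℝ) (n : ℤ) :
    polarPoint r (θ + n * (2 * Real.pi)) = polarPoint r θ := by
  simp only [polarPoint, Real.cos_add_int_mul_two_pi, Real.sin_add_int_mul_two_pi]

theorem exists_polarPoint_eq (x : EuclideanSpace ℝ (Fin 2)) : ∃ θ, polarPoint ‖x‖ θ = x := by
  set z : ℂ := ⟨x 0, x 1⟩ with hz
  have hn : ‖x‖ = ‖z‖ := by
    rw [EuclideanSpace.norm_eq, Complex.norm_eq_sqrt_sq_add_sq]
    simp [hz, Fin.sum_univ_two]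
  refine ⟨z.arg, ?_⟩
  rw [hn]
  ext i
  fin_cases i
  · simp [polarPoint, Complex.norm_mul_cos_arg, hz]
  · simp [polarPoint, Complex.norm_mul_sin_arg, hz]

/-- Move along a radius, then along a chord, which is at most its arc because `cos x ≥ 1 - x² / 2`.
This makes a spiral with bounded radius and radial speed Lipschitz. -/
theorem dist_polarPoint_le (r r' θ θ' : ℝ) :
    dist (polarPoint r θ) (polarPoint r' θ') ≤ |r - r'| + |r'| * |θ - θ'| := by
  refine (dist_triangle _ (polarPoint r' θ) _).trans ?_
  rw [dist_polarPoint_same_angle]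
  gcongr
  rw [← abs_mul, EuclideanSpace.dist_eq]
  refine Real.sqrt_le_left (abs_nonneg _) |>.2 ?_
  rw [sq_abs]
  simp only [polarPoint, Fin.sum_univ_two, Real.dist_eq, sq_abs]
  simp only [Matrix.cons_val_zero, Matrix.cons_val_one]
  have h1 := Real.one_sub_sq_div_two_le_cos (x := θ - θ')
  rw [Real.cos_sub] at h1
  have h2 := Real.sin_sq_add_cos_sq θ
  have h3 := Real.sin_sq_add_cos_sq θ'
  have h4 : (r' * Real.cos θ - r' * Real.cos θ') ^ 2 + (r' * Real.sin θ - r' * Real.sin θ') ^ 2 =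
      r' ^ 2 * (2 - 2 * (Real.cos θ * Real.cos θ' + Real.sin θ * Real.sin θ')) := by
    linear_combination r' ^ 2 * h2 + r' ^ 2 * h3
  rw [h4, mul_pow]
  exact mul_le_mul_of_nonneg_left (by linarith) (sq_nonneg _)

theorem volume_setOf_norm_mem_Ioo {r₁ r₂ : ℝ} (h₁ : 0 ≤ r₁) (h : r₁ < r₂) :
    volume {x : EuclideanSpace ℝ (Fin 2) | ‖x‖ ∈ Ioo r₁ r₂} =
      ENNReal.ofReal (Real.pi * (r₂ ^ 2 - r₁ ^ 2)) := by
  have e : {x : EuclideanSpace ℝ (Fin 2) | ‖x‖ ∈ Ioo r₁ r₂} =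
      Metric.ball 0 r₂ \ Metric.closedBall 0 r₁ := by
    ext x; simp [and_comm]
  rw [e, measure_sdiff (Metric.closedBall_subset_ball h)
    measurableSet_closedBall.nullMeasurableSet measure_closedBall_lt_top.ne,
    EuclideanSpace.volume_ball_fin_two, EuclideanSpace.volume_closedBall_fin_two,
    ← ENNReal.ofReal_pow (h₁.trans h.le), ← ENNReal.ofReal_pow h₁,
    ← ENNReal.ofReal_mul (by positivity), ← ENNReal.ofReal_mul (by positivity),
    ← ENNReal.ofReal_sub _ (by positivity)]
  congr 1; ring

/-! ### Areas of neighbourhoods of spirals and box dimension -/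

theorem tendsto_rpow_nhdsGT_zero {κ : ℝ} (hκ : 0 < κ) :
    Tendsto (fun ε : ℝ => ε ^ κ) (𝓝[>] 0) (𝓝 0) := by
  have := (Real.continuousAt_rpow_const 0 κ (Or.inr hκ.le)).tendsto
  rw [Real.zero_rpow hκ.ne'] at this
  exact this.mono_left nhdsWithin_le_nhds

/-- The area of the neighbourhoods of a Lipschitz curve that approaches the circle of radius `a` at
least as fast as `τ ^ (-p)`. -/
theorem exists_volume_thickening_le {γ : ℝ → EuclideanSpace ℝ (Fin 2)} {a L C p : ℝ} (ha : 0 < a)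
    (hL : 0 ≤ L) (hp : 0 < p) (hC : 0 ≤ C)
    (hlip : ∀ x ∈ Ici (0 : ℝ), ∀ y ∈ Ici (0 : ℝ), dist (γ x) (γ y) ≤ L * |x - y|)
    (hdecay : ∀ᶠ τ in atTop, |‖γ τ‖ - a| ≤ C * τ ^ (-p)) :
    ∃ D : ℝ, ∀ᶠ ε in 𝓝[>] (0 : ℝ),
      volume (Metric.thickening ε (γ '' Ici 0)) ≤ ENNReal.ofReal (D * ε ^ (p / (p + 1))) := by
  obtain ⟨T₀, hT₀⟩ := hdecay.exists_forall_of_atTop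
  set κ := p / (p + 1) with hκ
  have hκ0 : 0 < κ := by positivity
  have hκ1 : κ < 1 := by rw [hκ, div_lt_one (by positivity)]; linarith
  refine ⟨4 * Real.pi * a * (C + 1) + 2 * Real.pi * (L + 1) ^ 2, ?_⟩
  have hTlim : Tendsto (fun ε : ℝ => ε ^ (-(1 / (p + 1)))) (𝓝[>] 0) atTop :=
    tendsto_rpow_neg_nhdsGT_zero (by rw [neg_lt_zero]; positivity)
  have hwlim : Tendsto (fun ε : ℝ => (C + 1) * ε ^ κ) (𝓝[>] 0) (𝓝 0) := by
    simpa using (tendsto_rpow_nhdsGT_zero hκ0).const_mul (C + 1)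
  filter_upwards [hTlim.eventually (eventually_ge_atTop T₀), hwlim.eventually (gt_mem_nhds ha),
    self_mem_nhdsWithin, nhdsWithin_le_nhds (gt_mem_nhds (zero_lt_one' ℝ))] with ε hT hw hε hε1
  have hε : 0 < ε := hε
  -- This cut-off time balances the annulus width `T ^ (-p)` against the total area `T ε` of the
  -- balls: both equal `ε ^ κ`.
  set T := ε ^ (-(1 / (p + 1))) with hTd
  set w := (C + 1) * ε ^ κ with hwd
  have hT0 : 0 < T := by positivity
  have hw0 : 0 < w := by positivity
  have eT : T ^ (-p) = ε ^ κ := by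
    rw [hTd, ← Real.rpow_mul hε.le, hκ]; congr 1; field_simp
  have eTε : T * ε = ε ^ κ := by
    rw [hTd, hκ]; nth_rewrite 2 [← Real.rpow_one ε]
    rw [← Real.rpow_add hε]; congr 1; field_simp; ring
  have hε_le : ε ≤ ε ^ κ := by
    nth_rewrite 1 [← Real.rpow_one ε]
    exact Real.rpow_le_rpow_of_exponent_ge hε hε1.le hκ1.le
  set N := ⌊T / ε⌋₊ with hN
  have hcover : Metric.thickening ε (γ '' Ici 0) ⊆
      {x : EuclideanSpace ℝ (Fin 2) | ‖x‖ ∈ Ioo (a - w) (a + w)} ∪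
        ⋃ i ∈ Finset.range (N + 1), Metric.ball (γ (i * ε)) ((L + 1) * ε) := by
    intro x hx
    obtain ⟨_, ⟨τ, hτ, rfl⟩, hd⟩ := Metric.mem_thickening_iff.1 hx
    have hτ : 0 ≤ τ := hτ
    rcases le_or_gt T τ with h | h
    · left
      have h1 := hT₀ τ (hT.trans h)
      have h2 : τ ^ (-p) ≤ ε ^ κ := by
        rw [← eT]; exact Real.rpow_le_rpow_of_nonpos hT0 h (by linarith)
      have h3 : |‖x‖ - ‖γ τ‖| < ε := (abs_norm_sub_norm_le _ _).trans_lt (by rwa [← dist_eq_norm])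
      have h4 : |‖x‖ - a| < w := by
        calc |‖x‖ - a| ≤ |‖x‖ - ‖γ τ‖| + |‖γ τ‖ - a| := abs_sub_le _ _ _
          _ < ε ^ κ + C * ε ^ κ :=
            add_lt_add_of_lt_of_le (h3.trans_le hε_le) (h1.trans (by gcongr))
          _ = w := by rw [hwd]; ring
      rw [abs_lt] at h4
      exact ⟨by linarith [h4.1], by linarith [h4.2]⟩
    · right
      have hfl : (⌊τ / ε⌋₊ : ℝ) * ε ≤ τ := by
        rw [← le_div_iff₀ hε]; exact Nat.floor_le (by positivity)
      have hfl' : τ < ((⌊τ / ε⌋₊ : ℝ) + 1) * ε := by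
        rw [← div_lt_iff₀ hε]; exact Nat.lt_floor_add_one _
      refine mem_iUnion₂.2 ⟨⌊τ / ε⌋₊, ?_, ?_⟩
      · rw [Finset.mem_range, Nat.lt_succ_iff]
        exact Nat.floor_le_floor (by gcongr)
      · rw [Metric.mem_ball]
        have h1 := hlip τ hτ (⌊τ / ε⌋₊ * ε) (by rw [mem_Ici]; positivity)
        have h2 : |τ - ⌊τ / ε⌋₊ * ε| ≤ ε := by
          rw [abs_of_nonneg (by linarith)]; linarith
        calc dist x _ ≤ dist x (γ τ) + dist (γ τ) _ := dist_triangle _ _ _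
          _ < ε + L * ε := add_lt_add_of_lt_of_le hd (h1.trans (by gcongr))
          _ = _ := by ring
  refine (measure_mono hcover).trans ((measure_union_le _ _).trans ?_)
  have h1 : volume {x : EuclideanSpace ℝ (Fin 2) | ‖x‖ ∈ Ioo (a - w) (a + w)} =
      ENNReal.ofReal (4 * Real.pi * a * (C + 1) * ε ^ κ) := by
    rw [volume_setOf_norm_mem_Ioo (by linarith) (by linarith), hwd]
    congr 1; ring
  have h2 : volume (⋃ i ∈ Finset.range (N + 1), Metric.ball (γ (i * ε)) ((L + 1) * ε)) ≤
      ENNReal.ofReal (2 * Real.pi * (L + 1) ^ 2 * ε ^ κ) := by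
    refine (measure_biUnion_finset_le _ _).trans ?_
    simp only [EuclideanSpace.volume_ball_fin_two, Finset.sum_const, Finset.card_range,
      nsmul_eq_mul]
    rw [← ENNReal.ofReal_pow (by positivity), ← ENNReal.ofReal_mul (by positivity),
      ← ENNReal.ofReal_natCast, ← ENNReal.ofReal_mul (by positivity)]
    refine ENNReal.ofReal_le_ofReal ?_
    have hNle : (N : ℝ) * ε ≤ T := by
      rw [← le_div_iff₀ hε]; exact Nat.floor_le (by positivity)
    have h3 : ((N : ℝ) + 1) * ε ^ 2 ≤ 2 * ε ^ κ := by
      calc ((N : ℝ) + 1) * ε ^ 2 = N * ε * ε + ε * ε := by ring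
        _ ≤ T * ε + 1 * ε := by gcongr
        _ ≤ 2 * ε ^ κ := by rw [eTε]; linarith
    calc ((N + 1 : ℕ) : ℝ) * (((L + 1) * ε) ^ 2 * Real.pi)
        = Real.pi * (L + 1) ^ 2 * (((N : ℝ) + 1) * ε ^ 2) := by push_cast; ring
      _ ≤ Real.pi * (L + 1) ^ 2 * (2 * ε ^ κ) := by gcongr
      _ = _ := by ring
  calc _ ≤ ENNReal.ofReal (4 * Real.pi * a * (C + 1) * ε ^ κ) +
        ENNReal.ofReal (2 * Real.pi * (L + 1) ^ 2 * ε ^ κ) := add_le_add h1.le h2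
    _ = _ := by
      rw [← ENNReal.ofReal_add (by positivity) (by positivity)]; congr 1; ring

/-- The neighbourhoods of a spiral obeying a decay law contain one-sided neighbourhoods of the
circle. -/
theorem DecayLaw.exists_mem_thickening {m : ℕ} {v q : ℝ → ℝ} {T c₁ c₂ a s φ₀ σ : ℝ}
    (h : DecayLaw m v q T c₁ c₂) (hm : 1 ≤ m) (hT : 0 ≤ T) (hs : s = 1 ∨ s = -1)
    (hσ : σ = 1 ∨ σ = -1) : ∃ D w₀ : ℝ, 0 < D ∧ 0 < w₀ ∧
      ∀ (ε : ℝ) (x : EuclideanSpace ℝ (Fin 2)), 0 < s * (‖x‖ - a) → s * (‖x‖ - a) < w₀ →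
        D * (s * (‖x‖ - a)) ^ m < ε →
        x ∈ Metric.thickening ε ((fun τ => polarPoint (a + s * v τ) (φ₀ + σ * τ)) '' Ici 0) := by
  obtain ⟨T', hT'⟩ := ((h.tendsto.eventually (gt_mem_nhds zero_lt_one)).and
    (eventually_ge_atTop T)).exists_forall_of_atTop
  have hTT' : T ≤ T' := (hT' T' le_rfl).2
  replace h := h.mono hTT'
  replace hT := hT.trans hTT'
  have hv1 : ∀ τ, T' ≤ τ → v τ ≤ 1 := fun τ hτ => (hT' τ hτ).1.le
  have hpi := Real.two_pi_pos
  have hc₂ := h.c₂_pos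
  set κ := Real.exp (c₂ * (2 * Real.pi)) with hκ
  have hκ0 : 0 < κ := Real.exp_pos _
  refine ⟨2 * Real.pi * c₂ * κ ^ m, v (T' + 2 * Real.pi), by positivity,
    h.v_pos _ (by linarith), fun ε x hx0 hx1 hxε => ?_⟩
  set w := s * (‖x‖ - a) with hw
  obtain ⟨θ, hθ⟩ := exists_polarPoint_eq x
  -- The first time from `T'` on at which the spiral crosses the half-line through `x`; later
  -- crossings follow every `2π`.
  set τ₀ := toIcoMod hpi T' (σ * (θ - φ₀)) with hτ₀
  have hτ₀mem : τ₀ ∈ Ico T' (T' + 2 * Real.pi) := toIcoMod_mem_Ico hpi _ _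
  have hτk : ∀ k : ℕ, T' ≤ τ₀ + k * (2 * Real.pi) := fun k => by
    have : (0 : ℝ) ≤ k * (2 * Real.pi) := by positivity
    linarith [hτ₀mem.1]
  have hlim : Tendsto (fun k : ℕ => v (τ₀ + k * (2 * Real.pi))) atTop (𝓝 0) :=
    h.tendsto.comp (tendsto_atTop_add_const_left _ _
      (tendsto_natCast_atTop_atTop.atTop_mul_const hpi))
  have hex : ∃ k : ℕ, v (τ₀ + k * (2 * Real.pi)) < w := (hlim.eventually (gt_mem_nhds hx0)).exists
  classical
  -- The first crossing closer to the cycle than `x` has a predecessor, because `w < v (T' + 2π) ≤ v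
  -- τ₀`. Thus `x` lies between two consecutive turns.
  obtain ⟨k, hk⟩ : ∃ k, Nat.find hex = k + 1 := by
    refine Nat.exists_eq_add_one_of_ne_zero fun h0 => ?_
    have h1 := Nat.find_spec hex
    rw [h0, Nat.cast_zero, zero_mul, add_zero] at h1
    have h2 := h.antitoneOn (mem_Ici.2 hτ₀mem.1)
      (mem_Ici.2 (by linarith : T' ≤ T' + 2 * Real.pi)) hτ₀mem.2.le
    linarith
  have hk1 : v (τ₀ + k * (2 * Real.pi) + 2 * Real.pi) < w := by
    have h1 := Nat.find_spec hex
    rw [hk] at h1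
    convert h1 using 2
    push_cast; ring
  have hk0 : w ≤ v (τ₀ + k * (2 * Real.pi)) := by
    have := Nat.find_min hex (m := k) (by omega)
    exact not_lt.1 this
  set τ := τ₀ + k * (2 * Real.pi) with hτ
  have hT'τ : T' ≤ τ := hτk k
  have h1 : v τ ≤ κ * w :=
    (h.le_exp_mul hm hv1 hT'τ hpi.le).trans (mul_le_mul_of_nonneg_left hk1.le hκ0.le)
  have h2 := h.sub_le hT'τ hpi.le
  have hvτ := h.v_pos τ hT'τ
  have h3 : v τ - w < ε := by
    calc v τ - w ≤ 2 * Real.pi * (c₂ * v τ ^ m) := by linarith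
      _ ≤ 2 * Real.pi * (c₂ * (κ * w) ^ m) := by gcongr
      _ = 2 * Real.pi * c₂ * κ ^ m * w ^ m := by rw [mul_pow]; simp only [mul_assoc]
      _ < ε := hxε
  refine Metric.mem_thickening_iff.2 ⟨_, ⟨τ, hT.trans hT'τ, rfl⟩, ?_⟩
  have hss : s * s = 1 := by rcases hs with rfl | rfl <;> norm_num
  have hσσ : σ * σ = 1 := by rcases hσ with rfl | rfl <;> norm_num
  have hang : ∃ n : ℤ, φ₀ + σ * τ = θ + n * (2 * Real.pi) := by
    have hdiv : τ₀ = σ * (θ - φ₀) - toIcoDiv hpi T' (σ * (θ - φ₀)) • (2 * Real.pi) := rfl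
    rw [zsmul_eq_mul] at hdiv
    set d := toIcoDiv hpi T' (σ * (θ - φ₀)) with hd
    have : φ₀ + σ * τ = θ + σ * (((k : ℤ) - d : ℤ) : ℝ) * (2 * Real.pi) := by
      rw [hτ, hdiv]; push_cast; linear_combination (θ - φ₀) * hσσ
    rcases hσ with rfl | rfl
    · exact ⟨(k : ℤ) - d, by rw [this, one_mul]⟩
    · exact ⟨-((k : ℤ) - d), by rw [this, Int.cast_neg, neg_one_mul]⟩
  obtain ⟨n, hn⟩ := hang
  simp only [hn, polarPoint_add_int_mul_two_pi]
  rw [← hθ, dist_polarPoint_same_angle]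
  have e : ‖x‖ - (a + s * v τ) = s * (w - v τ) := by
    rw [hw]; linear_combination -(‖x‖ - a) * hss
  have habs : |s| = 1 := by rcases hs with rfl | rfl <;> norm_num
  rw [e, abs_mul, habs, one_mul, abs_sub_comm, abs_of_nonneg (by linarith)]
  exact h3

/-- The area of the neighbourhoods of a spiral obeying a decay law. -/
theorem DecayLaw.exists_le_volume_thickening {m : ℕ} {v q : ℝ → ℝ} {T c₁ c₂ a s φ₀ σ : ℝ}
    (h : DecayLaw m v q T c₁ c₂) (hm : 1 ≤ m) (hT : 0 ≤ T) (ha : 0 < a) (hs : s = 1 ∨ s = -1)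
    (hσ : σ = 1 ∨ σ = -1) : ∃ d : ℝ, 0 < d ∧ ∀ᶠ ε in 𝓝[>] (0 : ℝ),
      ENNReal.ofReal (d * ε ^ (1 / (m : ℝ))) ≤ volume (Metric.thickening ε
        ((fun τ => polarPoint (a + s * v τ) (φ₀ + σ * τ)) '' Ici 0)) := by
  obtain ⟨D, w₀, hD, hw₀, hsub⟩ := h.exists_mem_thickening (a := a) (φ₀ := φ₀) hm hT hs hσ
  have hm0 : (0 : ℝ) < m := by exact_mod_cast hm
  -- Chosen so that the width `η = b ε ^ (1/m)` solves `D η ^ m = ε`.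
  set b := (D⁻¹) ^ (1 / (m : ℝ)) with hb
  have hb0 : 0 < b := by positivity
  refine ⟨Real.pi * a * b, by positivity, ?_⟩
  have hlim : Tendsto (fun ε : ℝ => b * ε ^ (1 / (m : ℝ))) (𝓝[>] 0) (𝓝 0) := by
    simpa using (tendsto_rpow_nhdsGT_zero (κ := 1 / (m : ℝ)) (by positivity)).const_mul b
  filter_upwards [hlim.eventually (gt_mem_nhds hw₀), hlim.eventually (gt_mem_nhds ha),
    self_mem_nhdsWithin] with ε h1 h2 hε
  have hε : 0 < ε := hε
  set η := b * ε ^ (1 / (m : ℝ)) with hη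
  have hη0 : 0 < η := by positivity
  have hηm : D * η ^ m = ε := by
    rw [hη, hb, ← Real.mul_rpow (by positivity) hε.le, ← Real.rpow_natCast,
      ← Real.rpow_mul (by positivity), one_div, inv_mul_cancel₀ hm0.ne', Real.rpow_one]
    field_simp
  have hmem : ∀ x : EuclideanSpace ℝ (Fin 2), 0 < s * (‖x‖ - a) → s * (‖x‖ - a) < η →
      x ∈ Metric.thickening ε ((fun τ => polarPoint (a + s * v τ) (φ₀ + σ * τ)) '' Ici 0) :=
    fun x hx0 hx1 => hsub ε x hx0 (hx1.trans h1) (by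
      rw [← hηm]
      exact mul_lt_mul_of_pos_left (pow_lt_pow_left₀ hx1 hx0.le (by omega)) hD)
  rcases hs with rfl | rfl
  · refine le_trans ?_ (measure_mono (s := {x | ‖x‖ ∈ Ioo a (a + η)}) fun x hx =>
      hmem x (by linarith [hx.1]) (by linarith [hx.2]))
    rw [volume_setOf_norm_mem_Ioo ha.le (by linarith)]
    refine ENNReal.ofReal_le_ofReal ?_
    rw [mul_assoc, mul_assoc, ← hη]
    refine mul_le_mul_of_nonneg_left ?_ Real.pi_pos.le
    nlinarith
  · refine le_trans ?_ (measure_mono (s := {x | ‖x‖ ∈ Ioo (a - η) a}) fun x hx =>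
      hmem x (by linarith [hx.2]) (by linarith [hx.1]))
    rw [volume_setOf_norm_mem_Ioo (by linarith) (by linarith)]
    refine ENNReal.ofReal_le_ofReal ?_
    rw [mul_assoc, mul_assoc, ← hη]
    refine mul_le_mul_of_nonneg_left ?_ Real.pi_pos.le
    nlinarith

/-- Box dimension from bounds on the area of the neighbourhoods. -/
theorem hasBoxDim_of_volume_bounds {A : Set (EuclideanSpace ℝ (Fin 2))} {d b : ℝ} (hd0 : 0 < d)
    (hd2 : d < 2) (hne : A.Nonempty) (hbd : Bornology.IsBounded A) (hb : 0 < b)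
    (hup : ∀ η, 0 < η → η < 2 - d → ∃ D : ℝ, ∀ᶠ ε in 𝓝[>] (0 : ℝ),
      volume (Metric.thickening ε A) ≤ ENNReal.ofReal (D * ε ^ η))
    (hlow : ∀ᶠ ε in 𝓝[>] (0 : ℝ),
      ENNReal.ofReal (b * ε ^ (2 - d)) ≤ volume (Metric.thickening ε A)) :
    HasBoxDim A d := by
  have hupper : ∀ s, d < s → upperMinkowskiContent s A = 0 := by
    intro s hs
    -- The maximum with `0` keeps `η` positive when `s ≥ 2`.
    obtain ⟨η, hη1, hη2⟩ := exists_between (show max (2 - s) 0 < 2 - d by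
      rw [max_lt_iff]; constructor <;> linarith)
    rw [max_lt_iff] at hη1
    obtain ⟨D, hD⟩ := hup η hη1.2 hη2
    unfold upperMinkowskiContent
    refine Tendsto.limsup_eq ?_
    have hlim : Tendsto (fun ε : ℝ => ENNReal.ofReal (D * ε ^ (η - (2 - s)))) (𝓝[>] 0) (𝓝 0) := by
      have := (tendsto_rpow_nhdsGT_zero (κ := η - (2 - s)) (by linarith)).const_mul D
      rw [mul_zero] at this
      simpa using ENNReal.tendsto_ofReal this
    refine tendsto_of_tendsto_of_tendsto_of_le_of_le' tendsto_const_nhds hlim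
      (Eventually.of_forall fun _ => bot_le) ?_
    filter_upwards [hD, self_mem_nhdsWithin] with ε h1 hε
    have hε : 0 < ε := hε
    push_cast
    refine (ENNReal.div_le_div_right h1 _).trans_eq ?_
    rw [← ENNReal.ofReal_div_of_pos (by positivity), mul_div_assoc, ← Real.rpow_sub hε]
  have hlower : ∀ s, s < d → lowerMinkowskiContent s A ≠ 0 := by
    intro s hs
    have : ENNReal.ofReal b ≤ lowerMinkowskiContent s A := by
      unfold lowerMinkowskiContent
      refine le_liminf_of_le (by isBoundedDefault) ?_
      filter_upwards [hlow, self_mem_nhdsWithin, nhdsWithin_le_nhds (gt_mem_nhds (zero_lt_one' ℝ))]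
        with ε h1 hε hε1
      have hε : 0 < ε := hε
      push_cast
      refine le_trans ?_ (ENNReal.div_le_div_right h1 _)
      rw [← ENNReal.ofReal_div_of_pos (by positivity), mul_div_assoc, ← Real.rpow_sub hε]
      refine ENNReal.ofReal_le_ofReal ?_
      have := Real.one_le_rpow_of_pos_of_le_one_of_nonpos hε hε1.le
        (by linarith : 2 - d - (2 - s) ≤ 0)
      nlinarith
    intro h0
    rw [h0, nonpos_iff_eq_zero, ENNReal.ofReal_eq_zero] at this
    linarith
  have hle : ∀ s, lowerMinkowskiContent s A ≤ upperMinkowskiContent s A := fun s =>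
    liminf_le_limsup
  -- The contents at `s = d` itself do not affect the infimum.
  have hInf : ∀ S : Set ℝ, Ioi d ⊆ S → S ⊆ Ici d → sInf S = d := fun S h1 h2 =>
    le_antisymm
      (le_of_forall_gt_imp_ge_of_dense fun s hs => csInf_le ⟨d, fun x hx => h2 hx⟩ (h1 hs))
      (le_csInf ⟨d + 1, h1 (by simp)⟩ fun x hx => h2 hx)
  refine ⟨hne, hbd, hInf _ ?_ ?_, hInf _ ?_ ?_⟩
  · exact fun s hs => ⟨hd0.trans hs, hupper s hs⟩
  · rintro s ⟨-, hs⟩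
    by_contra hsd
    exact hlower s (not_le.1 hsd) (nonpos_iff_eq_zero.1 (hs ▸ hle s))
  · exact fun s hs => ⟨hd0.trans hs, nonpos_iff_eq_zero.1 (hupper s hs ▸ hle s)⟩
  · rintro s ⟨-, hs⟩
    by_contra hsd
    exact hlower s (not_le.1 hsd) hs

/-! ### The radial equation near a limit cycle -/

/-- Separation of variables: `Ψ = ∫ du / K` is strictly increasing, and `K u ≤ C u` forces it to
`-∞` at `0` by comparison with a logarithm. Its inverse `V` therefore lives on all of `(-∞, 0)`, and
`V (Ψ u₀ - τ)` never reaches `0` in finite time. -/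
theorem exists_solution_of_pos_field {K : ℝ → ℝ} {ε C u₀ : ℝ} (hcont : ContinuousOn K (Ioo 0 ε))
    (hpos : ∀ u ∈ Ioo 0 ε, 0 < K u) (hC : 0 < C) (hle : ∀ u ∈ Ioo 0 ε, K u ≤ C * u)
    (hu₀ : u₀ ∈ Ioo 0 ε) : ∃ U : ℝ → ℝ, U 0 = u₀ ∧ ∀ τ, 0 ≤ τ →
      0 < U τ ∧ U τ ≤ u₀ ∧ HasDerivAt U (-K (U τ)) τ := by
  -- A base point beyond `u₀` makes `Ψ u₀ < 0`, so that the solution is two-sidedly differentiable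
  -- at `τ = 0`.
  obtain ⟨u₁, hu₀₁, hu₁⟩ := exists_between hu₀.2
  have hu₁mem : u₁ ∈ Ioo 0 ε := ⟨hu₀.1.trans hu₀₁, hu₁⟩
  have hinv : ContinuousOn (fun x => (K x)⁻¹) (Ioo 0 ε) :=
    hcont.inv₀ fun u hu => (hpos u hu).ne'
  set Ψ : ℝ → ℝ := fun u => ∫ x in u₁..u, (K x)⁻¹ with hΨ
  have hΨd : ∀ u ∈ Ioo 0 ε, HasDerivAt Ψ (K u)⁻¹ u := fun u hu =>
    intervalIntegral.integral_hasDerivAt_right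
      (hinv.mono ((ordConnected_Ioo).uIcc_subset hu₁mem hu)).intervalIntegrable
      (hinv.stronglyMeasurableAtFilter isOpen_Ioo u hu)
      (hinv.continuousAt (isOpen_Ioo.mem_nhds hu))
  have hmono : StrictMonoOn Ψ (Ioo 0 ε) := by
    refine strictMonoOn_of_hasDerivWithinAt_pos (convex_Ioo 0 ε)
      (f' := fun u => (K u)⁻¹) (fun u hu => (hΨd u hu).continuousAt.continuousWithinAt) ?_ ?_
    · exact fun u hu => (hΨd u (interior_subset hu)).hasDerivWithinAt
    · exact fun u hu => inv_pos.2 (hpos u (interior_subset hu))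
  have hΨ₁ : Ψ u₁ = 0 := intervalIntegral.integral_same
  have hlog : ∀ u ∈ Ioc 0 u₁, Ψ u ≤ C⁻¹ * (Real.log u - Real.log u₁) := by
    have hsub : Ioc 0 u₁ ⊆ Ioo 0 ε := fun u hu => ⟨hu.1, hu.2.trans_lt hu₁⟩
    have hd : ∀ u ∈ Ioc 0 u₁, HasDerivAt (fun u => Ψ u - C⁻¹ * Real.log u)
        ((K u)⁻¹ - C⁻¹ * u⁻¹) u := fun u hu =>
      (hΨd u (hsub hu)).fun_sub ((Real.hasDerivAt_log hu.1.ne').const_mul _)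
    have hm : MonotoneOn (fun u => Ψ u - C⁻¹ * Real.log u) (Ioc 0 u₁) := by
      refine monotoneOn_of_hasDerivWithinAt_nonneg (convex_Ioc 0 u₁)
        (fun u hu => (hd u hu).continuousAt.continuousWithinAt)
        (fun u hu => (hd u (interior_subset hu)).hasDerivWithinAt) fun u hu => ?_
      have hu := hsub (interior_subset hu)
      rw [sub_nonneg, ← mul_inv]
      exact inv_anti₀ (hpos u hu) (hle u hu)
    intro u hu
    have := hm hu (right_mem_Ioc.2 hu₁mem.1) hu.2
    simp only [hΨ₁] at this
    linarith
  have hsurj : ∀ y, y < 0 → ∃ u ∈ Ioo 0 u₁, Ψ u = y := by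
    intro y hy
    set u' := u₁ * Real.exp (C * y) with hu'
    have hu'0 : 0 < u' := mul_pos hu₁mem.1 (Real.exp_pos _)
    have hu'1 : u' ≤ u₁ := by
      have : Real.exp (C * y) ≤ 1 := Real.exp_le_one_iff.2 (by nlinarith)
      nlinarith [hu₁mem.1]
    have hle' : Ψ u' ≤ y := by
      refine (hlog u' ⟨hu'0, hu'1⟩).trans_eq ?_
      rw [hu', Real.log_mul hu₁mem.1.ne' (Real.exp_pos _).ne', Real.log_exp]
      field_simp; ring
    have hc : ContinuousOn Ψ (Icc u' u₁) := fun u hu =>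
      (hΨd u ⟨hu'0.trans_le hu.1, hu.2.trans_lt hu₁⟩).continuousAt.continuousWithinAt
    obtain ⟨u, hu, huy⟩ := intermediate_value_Icc hu'1 hc ⟨hle', by rw [hΨ₁]; exact hy.le⟩
    refine ⟨u, ⟨hu'0.trans_le hu.1, lt_of_le_of_ne hu.2 ?_⟩, huy⟩
    rintro rfl
    rw [hΨ₁] at huy
    exact hy.ne huy.symm
  choose! V hV hΨV using hsurj
  have hsub : Ioo 0 u₁ ⊆ Ioo 0 ε := fun u hu => ⟨hu.1, hu.2.trans hu₁⟩
  have hVcont : ∀ y < 0, ContinuousAt V y := by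
    intro y hy
    have hVy := hV y hy
    refine tendsto_order.2 ⟨fun b hb => ?_, fun b hb => ?_⟩
    · set α := max b (V y / 2) with hα
      have hα1 : α < V y := max_lt hb (by linarith [hVy.1])
      have hα0 : α ∈ Ioo 0 ε :=
        ⟨(half_pos hVy.1).trans_le (le_max_right _ _), hα1.trans (hsub hVy).2⟩
      have h1 : Ψ α < y := by rw [← hΨV y hy]; exact hmono hα0 (hsub hVy) hα1
      filter_upwards [lt_mem_nhds h1, gt_mem_nhds hy] with z hz hz0
      rw [← hΨV z hz0] at hz
      exact (le_max_left _ _).trans_lt ((hmono.lt_iff_lt hα0 (hsub (hV z hz0))).1 hz)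
    · set β := min b ((V y + u₁) / 2) with hβ
      have hβ1 : V y < β := lt_min hb (by linarith [hVy.2])
      have hβ0 : β ∈ Ioo 0 ε :=
        ⟨hVy.1.trans hβ1, (min_le_right _ _).trans_lt (by linarith [hVy.2])⟩
      have h1 : y < Ψ β := by rw [← hΨV y hy]; exact hmono (hsub hVy) hβ0 hβ1
      filter_upwards [gt_mem_nhds h1, gt_mem_nhds hy] with z hz hz0
      rw [← hΨV z hz0] at hz
      exact ((hmono.lt_iff_lt (hsub (hV z hz0)) hβ0).1 hz).trans_le (min_le_left _ _)
  have hVd : ∀ y < 0, HasDerivAt V (K (V y)) y := fun y hy => by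
    have hVy := hsub (hV y hy)
    have := HasDerivAt.of_local_left_inverse (hVcont y hy) (hΨd _ hVy)
      (inv_ne_zero (hpos _ hVy).ne') (by
        filter_upwards [gt_mem_nhds hy] with z hz using hΨV z hz)
    rwa [inv_inv] at this
  have hy₀ : Ψ u₀ < 0 := by rw [← hΨ₁]; exact hmono hu₀ hu₁mem hu₀₁
  refine ⟨fun τ => V (Ψ u₀ - τ), ?_, fun τ hτ => ?_⟩
  · simp only [sub_zero]
    exact hmono.injOn (hsub (hV _ hy₀)) hu₀ (hΨV _ hy₀)
  · have hyτ : Ψ u₀ - τ < 0 := by linarith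
    refine ⟨(hV _ hyτ).1, ?_, ?_⟩
    · rw [← hmono.le_iff_le (hsub (hV _ hyτ)) hu₀, hΨV _ hyτ]
      linarith
    · have h1 : HasDerivAt (fun τ => Ψ u₀ - τ) (-1) τ := by
        simpa using (hasDerivAt_id τ).const_sub (Ψ u₀)
      exact ((hVd _ hyτ).comp τ h1).congr_deriv (by ring)

/-- A solution of `v' = ± K(v)` that stays in an interval `(0, ε)` where `K > 0` tends to `0`. -/
theorem tendsto_zero_of_pos_field {K v : ℝ → ℝ} {ε θ : ℝ} (hθ : θ = 1 ∨ θ = -1)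
    (hcont : ContinuousOn K (Ioc 0 ε)) (hpos : ∀ u ∈ Ioc 0 ε, 0 < K u)
    (hv : ∀ τ, 0 < τ → v τ ∈ Ioo 0 ε) (hd : ∀ τ, 0 < τ → HasDerivAt v (θ * K (v τ)) τ) :
    Tendsto v atTop (𝓝 0) := by
  have hθθ : θ * θ = 1 := by rcases hθ with rfl | rfl <;> norm_num
  have hθ1 : |θ| = 1 := by rcases hθ with rfl | rfl <;> norm_num
  -- If `v` stayed above `η`, the positive minimum of `K` on `[η, ε]` would make `θ v` grow at least
  -- linearly, although `v` is bounded.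
  have key : ∀ η, 0 < η → ∃ τ, 1 ≤ τ ∧ v τ < η := by
    intro η hη
    by_contra! hge
    have hne : (Icc η ε).Nonempty := ⟨v 1, hge 1 le_rfl, (hv 1 one_pos).2.le⟩
    have hsub : Icc η ε ⊆ Ioc 0 ε := fun u hu => ⟨hη.trans_le hu.1, hu.2⟩
    obtain ⟨u, hu, hmin⟩ := isCompact_Icc.exists_isMinOn hne (hcont.mono hsub)
    have hδ := hpos u (hsub hu)
    have hm := monotoneOn_Ici_of_hasDerivAt_nonneg (T := 1)
      (fun τ hτ => ((hd τ (by linarith)).const_mul θ).fun_sub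
        ((hasDerivAt_id τ).const_mul (K u))) (fun τ hτ => by
        have h1 : K u ≤ K (v τ) := hmin ⟨hge τ hτ, (hv τ (by linarith)).2.le⟩
        have h2 : θ * (θ * K (v τ)) = K (v τ) := by rw [← mul_assoc, hθθ, one_mul]
        linarith)
    have hbd : ∀ τ, 1 ≤ τ → |θ * v τ| ≤ ε := fun τ hτ => by
      have := hv τ (by linarith)
      rw [abs_mul, hθ1, one_mul, abs_of_pos this.1]; exact this.2.le
    obtain ⟨τ, hτ1, hτ2⟩ : ∃ τ, 1 ≤ τ ∧ 2 * ε + K u < K u * τ := by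
      obtain ⟨n, hn⟩ := exists_nat_gt ((2 * ε + K u) / K u)
      refine ⟨max n 1, le_max_right _ _, ?_⟩
      rw [div_lt_iff₀ hδ] at hn
      nlinarith [le_max_left (n : ℝ) 1]
    have h1 := hm self_mem_Ici hτ1 hτ1
    simp only [id, mul_one] at h1
    linarith [(abs_le.1 (hbd τ hτ1)).2, (abs_le.1 (hbd 1 le_rfl)).1]
  rcases hθ with rfl | rfl
  -- An increasing `v` cannot fall below `v 1`, so the sign `θ = 1` does not occur.
  · exfalso
    have hm := monotoneOn_Ici_of_hasDerivAt_nonneg (T := 1) (fun τ hτ => hd τ (by linarith))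
      (fun τ hτ => by
        have := hv τ (by linarith)
        rw [one_mul]; exact (hpos _ ⟨this.1, this.2.le⟩).le)
    obtain ⟨τ, hτ, h1⟩ := key (v 1) (hv 1 one_pos).1
    exact absurd (hm self_mem_Ici hτ hτ) (not_le.2 h1)
  · have hm := antitoneOn_Ici_of_hasDerivAt_nonpos (T := 1) (fun τ hτ => hd τ (by linarith))
      (fun τ hτ => by
        have := hv τ (by linarith)
        have := hpos _ ⟨this.1, this.2.le⟩
        linarith)
    refine tendsto_order.2 ⟨fun b hb => ?_, fun b hb => ?_⟩
    · filter_upwards [eventually_gt_atTop 0] with τ hτ using hb.trans (hv τ hτ).1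
    · obtain ⟨τ₁, hτ₁, h1⟩ := key b hb
      filter_upwards [eventually_ge_atTop τ₁] with τ hτ
      exact (hm hτ₁ (hτ₁.trans hτ) hτ).trans_lt h1

/-! ### Factorisation and sign of the field at the cycle -/

theorem continuousOn_radialField (l : ℕ) (c : Fin l → ℝ) :
    ContinuousOn (radialField l c) (Ioi 0) := fun _ hx =>
  (analyticAt_radialField l c hx).continuousAt.continuousWithinAt

/-- On the interval of radius `ε` around `a`, the field `f` is `(x - a) ^ m * g x`, where `g` does
not vanish and is Lipschitz at `a`. -/
structure LocalFactor (f : ℝ → ℝ) (a : ℝ) (m : ℕ) (g : ℝ → ℝ) (ε M C : ℝ) : Prop where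
  ε_pos : 0 < ε
  ε_lt : ε < a
  C_pos : 0 < C
  eq_mul : ∀ x, |x - a| ≤ ε → f x = (x - a) ^ m * g x
  mul_pos : ∀ x, |x - a| ≤ ε → 0 < g x * g a
  abs_sub_le : ∀ x, |x - a| ≤ ε → |g x - g a| ≤ M * |x - a|
  abs_le : ∀ x, |x - a| ≤ ε → |f x| ≤ C * |x - a|

theorem exists_localFactor {f : ℝ → ℝ} {a : ℝ} {m : ℕ} (ha : 0 < a) (hf : AnalyticAt ℝ f a)
    (hfa : f a = 0) (hm : analyticOrderAt f a = m) : ∃ g ε M C, LocalFactor f a m g ε M C := by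
  obtain ⟨g, hg, hg0, hfg⟩ := hf.analyticOrderAt_eq_natCast.1 hm
  obtain ⟨M, hM⟩ := hg.differentiableAt.isBigO_sub.bound
  have hO := hf.differentiableAt.isBigO_sub
  rw [hfa] at hO
  obtain ⟨C, hC0, hC⟩ := hO.exists_pos
  have hgg : ∀ᶠ x in 𝓝 a, 0 < g x * g a :=
    (hg.continuousAt.tendsto.mul_const (g a)).eventually
      (lt_mem_nhds (mul_self_pos.2 hg0))
  obtain ⟨δ, hδ, hball⟩ := Metric.eventually_nhds_iff.1
    (((hfg.and hM).and hC.bound).and hgg)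
  have hε : ∀ x, |x - a| ≤ min (δ / 2) (a / 2) → dist x a < δ := fun x hx => by
    rw [Real.dist_eq]
    exact (hx.trans (min_le_left _ _)).trans_lt (by linarith)
  refine ⟨g, min (δ / 2) (a / 2), M, C, by positivity,
    (min_le_right _ _).trans_lt (by linarith), hC0, fun x hx => ?_, fun x hx => ?_, fun x hx => ?_,
    fun x hx => ?_⟩
  · exact (hball (hε x hx)).1.1.1
  · exact (hball (hε x hx)).2
  · exact (hball (hε x hx)).1.1.2
  · simpa using (hball (hε x hx)).1.2

theorem abs_add_mul_sub {a s u : ℝ} (hs : s = 1 ∨ s = -1) : |a + s * u - a| = |u| := by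
  rcases hs with rfl | rfl <;> simp

/-- On either side of the cycle the field has a constant sign. -/
theorem LocalFactor.exists_sign {f g : ℝ → ℝ} {a ε M C s : ℝ} {m : ℕ}
    (h : LocalFactor f a m g ε M C) (hs : s = 1 ∨ s = -1) :
    ∃ σ : ℝ, (σ = 1 ∨ σ = -1) ∧ ∀ u ∈ Ioc 0 ε, 0 < -σ * s * f (a + s * u) := by
  have hga : g a ≠ 0 := fun h0 => by
    have := h.mul_pos a (by simpa using h.ε_pos.le)
    simp [h0] at this
  have hs0 : s ≠ 0 := by rcases hs with rfl | rfl <;> norm_num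
  have hne : s ^ (m + 1) * g a ≠ 0 := mul_ne_zero (pow_ne_zero _ hs0) hga
  -- `σ` is the direction of time in which orbits on the side `s` approach the cycle.
  obtain ⟨σ, hσ, hneg⟩ : ∃ σ : ℝ, (σ = 1 ∨ σ = -1) ∧ 0 < -σ * (s ^ (m + 1) * g a) := by
    rcases lt_or_gt_of_ne hne with h0 | h0
    · exact ⟨1, Or.inl rfl, by linarith⟩
    · exact ⟨-1, Or.inr rfl, by linarith⟩
  refine ⟨σ, hσ, fun u hu => ?_⟩
  have hx : |a + s * u - a| ≤ ε := by rw [abs_add_mul_sub hs, abs_of_pos hu.1]; exact hu.2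
  have h1 := h.mul_pos _ hx
  rw [h.eq_mul _ hx]
  -- The factor `g a ^ 2` produces `g x * g a`, whose sign is known.
  have h2 : 0 < -σ * s * ((a + s * u - a) ^ m * g (a + s * u)) * g a ^ 2 := by
    have : -σ * s * ((a + s * u - a) ^ m * g (a + s * u)) * g a ^ 2 =
        -σ * (s ^ (m + 1) * g a) * u ^ m * (g (a + s * u) * g a) := by
      rw [add_sub_cancel_left, mul_pow]; ring
    rw [this]
    have := pow_pos hu.1 m
    positivity
  exact pos_of_mul_pos_left h2 (sq_nonneg _)

/-! ### Time rays -/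

/-- Elapsed time `τ ≥ 0` with a sign `σ` lets forward and backward half-trajectories be treated
together. -/
theorem IsTimeRay.exists_param {I : Set ℝ} {F : Filter ℝ} (h : IsTimeRay I F) :
    ∃ σ t₀ : ℝ, (σ = 1 ∨ σ = -1) ∧ I = (fun τ => t₀ + σ * τ) '' Ici 0 ∧
      F = map (fun τ => t₀ + σ * τ) atTop := by
  rcases h with ⟨t₀, rfl, rfl⟩ | ⟨t₀, rfl, rfl⟩
  · refine ⟨1, t₀, Or.inl rfl, ?_, ?_⟩
    · simp
    · simp only [one_mul]
      exact (OrderIso.addLeft t₀).map_atTop.symm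
  · refine ⟨-1, t₀, Or.inr rfl, ?_, ?_⟩
    · simp [← sub_eq_add_neg]
    · have h1 : (fun τ : ℝ => t₀ + -1 * τ) = (fun x => t₀ + x) ∘ Neg.neg := by
        ext; simp
      rw [h1, ← map_map, map_neg_atTop]
      exact (OrderIso.addLeft t₀).map_atBot.symm

theorem IsSolutionOn.comp_ray {l : ℕ} {c : Fin l → ℝ} {σ t₀ : ℝ} {ρ φ : ℝ → ℝ}
    (h : IsSolutionOn l c ((fun τ => t₀ + σ * τ) '' Ici 0) ρ φ) {τ : ℝ} (hτ : τ ∈ Ici (0 : ℝ)) :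
    HasDerivWithinAt (fun τ => ρ (t₀ + σ * τ)) (σ * radialField l c (ρ (t₀ + σ * τ))) (Ici 0) τ ∧
      φ (t₀ + σ * τ) = φ t₀ + σ * τ := by
  have hray : ∀ τ, HasDerivWithinAt (fun τ => t₀ + σ * τ) σ (Ici 0) τ := fun τ => by
    simpa using (((hasDerivAt_id τ).const_mul σ).const_add t₀).hasDerivWithinAt (s := Ici 0)
  have hφ : ∀ τ ∈ Ici (0 : ℝ), HasDerivWithinAt (fun τ => φ (t₀ + σ * τ)) σ (Ici 0) τ :=
    fun τ hτ => (HasDerivWithinAt.comp τ (h _ ⟨τ, hτ, rfl⟩).2.2 (hray τ)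
      (mapsTo_image _ _)).congr_deriv (one_mul σ)
  constructor
  · have := HasDerivWithinAt.comp τ (h _ ⟨τ, hτ, rfl⟩).2.1 (hray τ) (mapsTo_image _ _)
    exact this.congr_deriv (mul_comm _ _)
  · simpa using eq_add_mul_of_hasDerivWithinAt_const (convex_Ici 0) hφ self_mem_Ici hτ

theorem exists_abs_le_of_tendsto {y : ℝ → ℝ} {x : ℝ} (hc : ContinuousOn y (Ici 0))
    (hy : Tendsto y atTop (𝓝 x)) : ∃ B, 0 ≤ B ∧ ∀ τ ∈ Ici (0 : ℝ), |y τ| ≤ B := by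
  obtain ⟨T, hT⟩ := (hy.abs.eventually (gt_mem_nhds (lt_add_one |x|))).exists_forall_of_atTop
  obtain ⟨B, hB⟩ := (isCompact_Icc (a := (0 : ℝ)) (b := T)).exists_bound_of_continuousOn
    (hc.mono Icc_subset_Ici_self)
  refine ⟨max B (|x| + 1), le_max_of_le_right (by positivity), fun τ hτ => ?_⟩
  rcases le_total T τ with h | h
  · exact le_max_of_le_right (hT τ h).le
  · exact le_max_of_le_left (hB τ ⟨hτ, h⟩)

/-! ### Spirals tending to a limit cycle -/

section Spiral

variable {l m : ℕ} {c : Fin l → ℝ} {a s ε M C σ t₀ : ℝ} {g : ℝ → ℝ} {I : Set ℝ} {F : Filter ℝ}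
  {ρ φ : ℝ → ℝ}

theorem IsSpiralTo.s_mul_s (h : IsSpiralTo l c a s I F ρ φ) : s * s = 1 := by
  rcases h.side with rfl | rfl <;> norm_num

theorem IsSpiralTo.tendsto_ray (h : IsSpiralTo l c a s I F ρ φ)
    (hF : F = map (fun τ => t₀ + σ * τ) atTop) :
    Tendsto (fun τ => ρ (t₀ + σ * τ)) atTop (𝓝 a) := by
  have := h.tendsto
  rwa [hF, tendsto_map'_iff] at this

/-- The distance of a spiral to the cycle obeys a decay law. -/
theorem IsSpiralTo.exists_decayLaw (h : IsSpiralTo l c a s I F ρ φ)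
    (hf : LocalFactor (radialField l c) a m g ε M C) (hσ : σ = 1 ∨ σ = -1)
    (hI : I = (fun τ => t₀ + σ * τ) '' Ici 0) (hF : F = map (fun τ => t₀ + σ * τ) atTop) :
    σ * s ^ (m + 1) * g a < 0 ∧ ∃ (T c₁ c₂ : ℝ) (w : ℝ → ℝ), 0 ≤ T ∧
      DecayLaw m (fun τ => s * (ρ (t₀ + σ * τ) - a)) (fun τ => -w τ) T c₁ c₂ ∧
      ∀ τ, T ≤ τ → |w τ - σ * s ^ (m + 1) * g a * (s * (ρ (t₀ + σ * τ) - a)) ^ m| ≤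
        M * (s * (ρ (t₀ + σ * τ) - a)) ^ (m + 1) := by
  subst hI
  have hss := h.s_mul_s
  have hs1 : |s| = 1 := by rcases h.side with rfl | rfl <;> norm_num
  have hσ1 : |σ| = 1 := by rcases hσ with rfl | rfl <;> norm_num
  have hs0 : s ≠ 0 := by rcases h.side with rfl | rfl <;> norm_num
  have hσ0 : σ ≠ 0 := by rcases hσ with rfl | rfl <;> norm_num
  have hga : g a ≠ 0 := fun h0 => by
    have := hf.mul_pos a (by simpa using hf.ε_pos.le)
    simp [h0] at this
  have hρ := h.tendsto_ray hF
  have hv : Tendsto (fun τ => s * (ρ (t₀ + σ * τ) - a)) atTop (𝓝 0) := by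
    simpa using (hρ.sub_const a).const_mul s
  -- Starting at `1` avoids the end point of the ray, where only a one-sided derivative is given.
  have hpos : ∀ τ, (1 : ℝ) ≤ τ → 0 < s * (ρ (t₀ + σ * τ) - a) := fun τ hτ =>
    h.pos _ ⟨τ, mem_Ici.2 (by linarith), rfl⟩
  obtain ⟨hQ, T, c₁, c₂, hT, hlaw, hw⟩ := exists_decayLaw (m := m) (M := M) (T₀ := 1)
    (Q := σ * s ^ (m + 1) * g a)
    (w := fun τ => s * (σ * radialField l c (ρ (t₀ + σ * τ))))
    (mul_ne_zero (mul_ne_zero hσ0 (pow_ne_zero _ hs0)) hga)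
    hpos
    (fun τ hτ => (((h.sol.comp_ray (mem_Ici.2 (by linarith : (0 : ℝ) ≤ τ))).1.hasDerivAt
      (Ici_mem_nhds (by linarith))).sub_const a).const_mul s) hv (by
      have hball : ∀ᶠ τ in atTop, |ρ (t₀ + σ * τ) - a| ≤ ε := by
        have := (hρ.sub_const a).abs
        rw [sub_self, abs_zero] at this
        exact (this.eventually (gt_mem_nhds hf.ε_pos)).mono fun _ h => h.le
      filter_upwards [hball, eventually_ge_atTop 1] with τ hτ hτ1
      set x := ρ (t₀ + σ * τ) with hx
      have hvx : |x - a| = s * (x - a) := by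
        rw [← abs_of_pos (hpos τ hτ1), abs_mul, hs1, one_mul]
      have hpow : (x - a) ^ m = s ^ m * (s * (x - a)) ^ m := by
        rw [← mul_pow, ← mul_assoc, hss, one_mul]
      rw [hf.eq_mul x hτ, hpow]
      have e : s * (σ * (s ^ m * (s * (x - a)) ^ m * g x)) -
          σ * s ^ (m + 1) * g a * (s * (x - a)) ^ m =
          σ * s ^ (m + 1) * ((s * (x - a)) ^ m * (g x - g a)) := by ring
      rw [e, abs_mul, abs_mul, abs_mul, abs_pow, hσ1, hs1, one_pow, one_mul, one_mul, abs_pow,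
        abs_of_pos (hpos τ hτ1)]
      calc (s * (x - a)) ^ m * |g x - g a| ≤ (s * (x - a)) ^ m * (M * (s * (x - a))) := by
            refine mul_le_mul_of_nonneg_left ?_ (pow_nonneg (hpos τ hτ1).le m)
            rw [← hvx]; exact hf.abs_sub_le x hτ
        _ = _ := by ring)
  exact ⟨hQ, T, c₁, c₂, _, by linarith, hlaw, hw⟩

theorem comparable_map {T : ℝ → ℝ} {f₁ f₂ : ℝ → ℝ}
    (h : Comparable atTop (fun τ => f₁ (T τ)) fun τ => f₂ (T τ)) :
    Comparable (map T atTop) f₁ f₂ := by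
  obtain ⟨c₁, c₂, h1, h2, h3⟩ := h
  exact ⟨c₁, c₂, h1, h2, eventually_map.2 h3⟩

theorem Comparable.congr_right {f g₁ g₂ : ℝ → ℝ} (h : Comparable atTop f g₁)
    (hg : ∀ τ, 0 ≤ τ → g₁ τ = g₂ τ) : Comparable atTop f g₂ := by
  obtain ⟨c₁, c₂, h1, h2, h3⟩ := h
  refine ⟨c₁, c₂, h1, h2, ?_⟩
  filter_upwards [h3, eventually_ge_atTop 0] with τ hτ hτ0
  rwa [← hg τ hτ0]

theorem comparable_exp_const_mul {k : ℝ} {f : ℝ → ℝ} :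
    Comparable atTop (fun τ => Real.exp (f τ)) fun τ => Real.exp (k + f τ) := by
  refine ⟨Real.exp (-k), Real.exp (-k), Real.exp_pos _, Real.exp_pos _,
    Eventually.of_forall fun τ => ?_⟩
  rw [← Real.exp_add, neg_add_cancel_left]
  exact ⟨le_rfl, le_rfl⟩

/-- In elapsed time the exponent is `σ (g a) τ`, and `σ τ = φ - φ t₀`, so the signs of side and time
disappear: `β = -g a` serves every spiral, and the initial angle only changes the constants. -/
theorem IsSpiralTo.comparable_exp (h : IsSpiralTo l c a s I F ρ φ)
    (hf : LocalFactor (radialField l c) a 1 g ε M C) :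
    Comparable F (fun t => s * (ρ t - a)) fun t => Real.exp (-(-g a) * φ t) := by
  obtain ⟨σ, t₀, hσ, hI, hF⟩ := h.ray.exists_param
  obtain ⟨-, T, c₁, c₂, w, hT, hlaw, hw⟩ := h.exists_decayLaw hf hσ hI hF
  have hss := h.s_mul_s
  subst hI
  rw [hF]
  refine comparable_map ?_
  have h1 := hlaw.comparable_exp (b := -(σ * g a)) (M := M) fun τ hτ => by
    have := hw τ hτ
    rw [pow_one] at this
    rw [← abs_neg]
    convert this using 2
    linear_combination (σ * g a * (s * (ρ (t₀ + σ * τ) - a))) * hss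
  refine (h1.trans (comparable_exp_const_mul (k := g a * φ t₀))).congr_right fun τ hτ => ?_
  rw [(h.sol.comp_ray hτ).2]
  ring_nf

theorem IsSpiralTo.comparable_rpow (h : IsSpiralTo l c a s I F ρ φ) (hm : 1 < m)
    (hf : LocalFactor (radialField l c) a m g ε M C) :
    Comparable F (fun t => s * (ρ t - a)) fun t => |φ t| ^ (-1 / ((m : ℝ) - 1)) := by
  obtain ⟨k, rfl⟩ := Nat.exists_eq_add_of_le' (show 2 ≤ m from hm)
  obtain ⟨σ, t₀, hσ, hI, hF⟩ := h.ray.exists_param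
  obtain ⟨-, T, c₁, c₂, w, hT, hlaw, hw⟩ := h.exists_decayLaw hf hσ hI hF
  subst hI
  rw [hF]
  refine comparable_map ?_
  have e : ((k + 2 : ℕ) : ℝ) - 1 = k + 1 := by push_cast; ring
  rw [e]
  have hp : -1 / ((k : ℝ) + 1) ≤ 0 := div_nonpos_of_nonpos_of_nonneg (by norm_num) (by positivity)
  refine (hlaw.comparable_rpow.trans (comparable_rpow_abs_affine (φ₀ := φ t₀) hp hσ)).congr_right
    fun τ hτ => ?_
  rw [(h.sol.comp_ray hτ).2]

/-- Power upper bounds for the distance to the cycle. -/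
theorem DecayLaw.exists_le_rpow {v q : ℝ → ℝ} {T c₁ c₂ b K p : ℝ} (h : DecayLaw m v q T c₁ c₂)
    (hm : 1 ≤ m) (hb : 0 < b) (hK : ∀ τ, T ≤ τ → |q τ - b * v τ ^ m| ≤ K * v τ ^ (m + 1))
    (hp0 : 0 < p) (hp : p / (p + 1) < 1 / m) :
    ∃ D, 0 ≤ D ∧ ∀ᶠ τ in atTop, v τ ≤ D * τ ^ (-p) := by
  rcases hm.eq_or_lt with rfl | hm
  · obtain ⟨d₁, d₂, -, hd₂, hcomp⟩ := h.comparable_exp (b := b) (M := K) (by simpa using hK)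
    refine ⟨d₂, hd₂.le, ?_⟩
    filter_upwards [hcomp, (isLittleO_exp_neg_mul_rpow_atTop hb (-p)).bound one_pos,
      eventually_gt_atTop 0] with τ h1 h2 h3
    rw [Real.norm_eq_abs, Real.norm_eq_abs, one_mul, abs_of_pos (Real.exp_pos _),
      abs_of_pos (by positivity)] at h2
    exact h1.2.trans (mul_le_mul_of_nonneg_left h2 hd₂.le)
  · obtain ⟨k, rfl⟩ := Nat.exists_eq_add_of_le' (show 2 ≤ m from hm)
    obtain ⟨d₁, d₂, -, hd₂, hcomp⟩ := h.comparable_rpow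
    refine ⟨d₂, hd₂.le, ?_⟩
    have hk : (0 : ℝ) < k + 1 := by positivity
    -- The condition `p / (p + 1) < 1 / m` amounts to `p < 1 / (m - 1)`.
    have hle : -1 / ((k : ℝ) + 1) ≤ -p := by
      rw [div_le_iff₀ hk]
      rw [div_lt_div_iff₀ (by positivity) (by positivity)] at hp
      push_cast at hp
      linarith
    filter_upwards [hcomp, eventually_ge_atTop 1] with τ h1 h2
    exact h1.2.trans (mul_le_mul_of_nonneg_left (Real.rpow_le_rpow_of_exponent_le h2 hle) hd₂.le)

theorem IsSpiralTo.hasBoxDim (h : IsSpiralTo l c a s I F ρ φ) (hm : 1 ≤ m) (ha : 0 < a)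
    (hf : LocalFactor (radialField l c) a m g ε M C) :
    HasBoxDim (orbitSet I ρ φ) (2 - 1 / (m : ℝ)) := by
  obtain ⟨σ, t₀, hσ, hI, hF⟩ := h.ray.exists_param
  obtain ⟨hQ, T, c₁, c₂, w, hT, hlaw, hw⟩ := h.exists_decayLaw hf hσ hI hF
  have hss := h.s_mul_s
  have hlim := h.tendsto_ray hF
  subst hI
  have hs1 : |s| = 1 := by rcases h.side with rfl | rfl <;> norm_num
  have hσ1 : |σ| = 1 := by rcases hσ with rfl | rfl <;> norm_num
  set γ : ℝ → EuclideanSpace ℝ (Fin 2) :=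
    fun τ => polarPoint (a + s * (s * (ρ (t₀ + σ * τ) - a))) (φ t₀ + σ * τ) with hγ
  have hγρ : ∀ τ, γ τ = polarPoint (ρ (t₀ + σ * τ)) (φ t₀ + σ * τ) := fun τ => by
    simp only [hγ, ← mul_assoc, hss, one_mul, add_sub_cancel]
  have horb : orbitSet ((fun τ => t₀ + σ * τ) '' Ici 0) ρ φ = γ '' Ici 0 := by
    rw [orbitSet, image_image]
    refine image_congr fun τ hτ => ?_
    rw [hγρ, (h.sol.comp_ray hτ).2]
  have hρpos : ∀ τ ∈ Ici (0 : ℝ), 0 < ρ (t₀ + σ * τ) := fun τ hτ => (h.sol _ ⟨τ, hτ, rfl⟩).1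
  have hρc : ContinuousOn (fun τ => ρ (t₀ + σ * τ)) (Ici 0) := fun τ hτ =>
    (h.sol.comp_ray hτ).1.continuousWithinAt
  obtain ⟨B, hB0, hB⟩ := exists_abs_le_of_tendsto hρc hlim
  obtain ⟨B', hB'0, hB'⟩ := exists_abs_le_of_tendsto
    (y := fun τ => radialField l c (ρ (t₀ + σ * τ)))
    ((continuousOn_radialField l c).comp hρc hρpos)
    ((analyticAt_radialField l c ha).continuousAt.tendsto.comp hlim)
  have hlip : ∀ x ∈ Ici (0 : ℝ), ∀ y ∈ Ici (0 : ℝ), dist (γ x) (γ y) ≤ (B' + B) * |x - y| := by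
    intro x hx y hy
    rw [hγρ, hγρ]
    refine (dist_polarPoint_le _ _ _ _).trans ?_
    have h1 := (convex_Ici (0 : ℝ)).norm_image_sub_le_of_norm_hasDerivWithin_le (C := B')
      (fun τ hτ => (h.sol.comp_ray hτ).1)
      (fun τ hτ => by rw [Real.norm_eq_abs, abs_mul, hσ1, one_mul]; exact hB' τ hτ) hy hx
    have h2 : |φ t₀ + σ * x - (φ t₀ + σ * y)| = |x - y| := by
      rw [add_sub_add_left_eq_sub, ← mul_sub, abs_mul, hσ1, one_mul]
    rw [h2, add_mul]
    exact add_le_add h1 (mul_le_mul_of_nonneg_right (hB y hy) (abs_nonneg _))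
  have hm0 : (1 : ℝ) ≤ m := by exact_mod_cast hm
  have hm1 : 1 / (m : ℝ) ≤ 1 := by rw [div_le_one (by linarith)]; exact hm0
  have hm2 : 0 < 1 / (m : ℝ) := by positivity
  rw [horb]
  obtain ⟨d, hd, hlow⟩ := hlaw.exists_le_volume_thickening (a := a) (φ₀ := φ t₀) hm hT ha h.side hσ
  refine hasBoxDim_of_volume_bounds (by linarith) (by linarith) ⟨γ 0, 0, self_mem_Ici, rfl⟩ ?_ hd
    (fun η hη0 hη1 => ?_) ?_
  · refine isBounded_iff_forall_norm_le.2 ⟨B, ?_⟩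
    rintro _ ⟨τ, hτ, rfl⟩
    rw [hγρ, norm_polarPoint]
    exact hB τ hτ
  · have hη1' : η < 1 / m := by linarith
    have h1η : 0 < 1 - η := by linarith
    -- The decay exponent `η / (1 - η)` is the preimage of `η` under `p ↦ p / (p + 1)`.
    have hp : η / (1 - η) / (η / (1 - η) + 1) = η := by
      have : η / (1 - η) + 1 = 1 / (1 - η) := by field_simp; ring
      rw [this]; field_simp
    obtain ⟨D, hD0, hD⟩ := hlaw.exists_le_rpow (b := -(σ * s ^ (m + 1) * g a)) (K := M)
      (p := η / (1 - η)) hm (by linarith) (fun τ hτ => by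
        rw [← abs_neg]
        convert hw τ hτ using 2
        ring) (by positivity) (by rw [hp]; exact hη1')
    obtain ⟨D', hD'⟩ := exists_volume_thickening_le (γ := γ) (L := B' + B) (p := η / (1 - η)) ha
      (by positivity) (by positivity) hD0 hlip (by
        filter_upwards [hD, eventually_ge_atTop 0] with τ hτ hτ0
        rw [hγρ, norm_polarPoint, abs_of_pos (hρpos τ hτ0)]
        refine le_trans (le_of_eq ?_) hτ
        rw [← abs_of_pos (h.pos _ ⟨τ, hτ0, rfl⟩), abs_mul, hs1, one_mul])
    rw [hp] at hD'
    exact ⟨D', hD'⟩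
  · have e : 2 - (2 - 1 / (m : ℝ)) = 1 / m := by ring
    rw [e]; exact hlow

/-- Through every point close to the cycle passes a half-trajectory that stays between the cycle and
the point. -/
theorem LocalFactor.exists_halfTrajectory (hf : LocalFactor (radialField l c) a m g ε M C)
    (hs : s = 1 ∨ s = -1) {ρ₀ : ℝ} (φ₀ : ℝ) (h0 : 0 < s * (ρ₀ - a)) (h1 : s * (ρ₀ - a) < ε) :
    ∃ (I : Set ℝ) (F : Filter ℝ) (ρ φ : ℝ → ℝ), IsTimeRay I F ∧ IsSolutionOn l c I ρ φ ∧
      (∃ t₀ ∈ I, ρ t₀ = ρ₀ ∧ φ t₀ = φ₀) ∧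
      ∀ t ∈ I, 0 < s * (ρ t - a) ∧ s * (ρ t - a) ≤ s * (ρ₀ - a) := by
  obtain ⟨σ, hσ, hpos⟩ := hf.exists_sign hs
  have hss : s * s = 1 := by rcases hs with rfl | rfl <;> norm_num
  have hσσ : σ * σ = 1 := by rcases hσ with rfl | rfl <;> norm_num
  have hs1 : |s| = 1 := by rcases hs with rfl | rfl <;> norm_num
  have hσ1 : |σ| = 1 := by rcases hσ with rfl | rfl <;> norm_num
  have hapos : ∀ u, |u| ≤ ε → 0 < a + s * u := fun u hu => by
    have := abs_add_mul_sub (a := a) (u := u) hs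
    have := neg_abs_le (a + s * u - a)
    linarith [hf.ε_lt]
  -- Here `K` is the speed at which the distance to the cycle shrinks when time runs in the
  -- direction `σ`.
  obtain ⟨U, hU0, hU⟩ := exists_solution_of_pos_field (ε := ε)
    (K := fun u => -σ * s * radialField l c (a + s * u))
    (ContinuousOn.mul continuousOn_const ((continuousOn_radialField l c).comp (by fun_prop)
      fun u hu => hapos u (by rw [abs_of_pos hu.1]; exact hu.2.le)))
    (fun u hu => hpos u ⟨hu.1, hu.2.le⟩) hf.C_pos
    (fun u hu => by
      have hx := abs_add_mul_sub (a := a) (u := u) hs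
      rw [abs_of_pos hu.1] at hx
      have := hf.abs_le (a + s * u) (hx.le.trans hu.2.le)
      rw [hx] at this
      refine (le_abs_self _).trans ?_
      rwa [abs_mul, abs_mul, abs_neg, hσ1, hs1, one_mul, one_mul]) ⟨h0, h1⟩
  have hsol : ∀ I : Set ℝ, (∀ t ∈ I, 0 ≤ σ * t) →
      IsSolutionOn l c I (fun t => a + s * U (σ * t)) (fun t => φ₀ + t) := by
    intro I hI t ht
    obtain ⟨hU1, hU2, hU3⟩ := hU _ (hI t ht)
    refine ⟨hapos _ ?_, ?_, ?_⟩
    · rw [abs_of_pos hU1]; linarith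
    · have hm : HasDerivAt (fun t => σ * t) σ t := by simpa using (hasDerivAt_id t).const_mul σ
      refine (((hU3.comp t hm).const_mul s).const_add a).hasDerivWithinAt.congr_deriv ?_
      linear_combination (radialField l c (a + s * U (σ * t))) * (σ * σ * hss + hσσ)
    · simpa using ((hasDerivAt_id t).const_add φ₀).hasDerivWithinAt (s := I)
  have hbd : ∀ t, 0 ≤ σ * t → 0 < s * (a + s * U (σ * t) - a) ∧
      s * (a + s * U (σ * t) - a) ≤ s * (ρ₀ - a) := fun t ht => by
    rw [add_sub_cancel_left, ← mul_assoc, hss, one_mul]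
    exact ⟨(hU _ ht).1, (hU _ ht).2.1⟩
  have hini : a + s * U (σ * 0) = ρ₀ ∧ φ₀ + 0 = φ₀ := by
    rw [mul_zero, hU0, ← mul_assoc, hss]; constructor <;> ring
  rcases hσ with rfl | rfl
  · have hI : ∀ t ∈ Ici (0 : ℝ), 0 ≤ 1 * t := fun t ht => by simpa using ht
    exact ⟨Ici 0, atTop, _, _, Or.inl ⟨0, rfl, rfl⟩, hsol _ hI, ⟨0, self_mem_Ici, hini⟩,
      fun t ht => hbd t (hI t ht)⟩
  · have hI : ∀ t ∈ Iic (0 : ℝ), 0 ≤ -1 * t := fun t ht => by simpa using ht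
    exact ⟨Iic 0, atBot, _, _, Or.inr ⟨0, rfl, rfl⟩, hsol _ hI, ⟨0, self_mem_Iic, hini⟩,
      fun t ht => hbd t (hI t ht)⟩

/-- A half-trajectory that stays on one side of the cycle, close to it, tends to it. -/
theorem LocalFactor.isSpiralTo (hf : LocalFactor (radialField l c) a m g ε M C)
    (hs : s = 1 ∨ s = -1) (hray : IsTimeRay I F) (hsol : IsSolutionOn l c I ρ φ)
    (hI : ∀ t ∈ I, 0 < s * (ρ t - a) ∧ s * (ρ t - a) < ε) : IsSpiralTo l c a s I F ρ φ := by
  refine ⟨hs, hray, hsol, fun t ht => (hI t ht).1, ?_⟩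
  obtain ⟨σ, t₀, hσ, rfl, rfl⟩ := hray.exists_param
  obtain ⟨θ, hθ, hpos⟩ := hf.exists_sign hs
  have hss : s * s = 1 := by rcases hs with rfl | rfl <;> norm_num
  have hθθ : θ * θ = 1 := by rcases hθ with rfl | rfl <;> norm_num
  have hmem : ∀ τ : ℝ, 0 < τ → t₀ + σ * τ ∈ (fun τ => t₀ + σ * τ) '' Ici (0 : ℝ) :=
    fun τ hτ => ⟨τ, hτ.le, rfl⟩
  have hx : ∀ x, a + s * (s * (x - a)) = x := fun x => by
    rw [← mul_assoc, hss]; ring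
  have hv : Tendsto (fun τ => s * (ρ (t₀ + σ * τ) - a)) atTop (𝓝 0) := by
    -- `θ` is the approaching direction of time and `σ` that of the ray, so `v' = -σ θ K(v)`. If
    -- they disagreed, the sign would be `+1`, which the lemma rules out.
    refine tendsto_zero_of_pos_field (ε := ε) (θ := -σ * θ)
      (K := fun u => -θ * s * radialField l c (a + s * u)) ?_
      (ContinuousOn.mul continuousOn_const ((continuousOn_radialField l c).comp (by fun_prop)
        fun u hu => ?_)) hpos (fun τ hτ => hI _ (hmem τ hτ)) fun τ hτ => ?_
    · rcases hσ with rfl | rfl <;> rcases hθ with rfl | rfl <;> norm_num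
    · have h1 := abs_add_mul_sub (a := a) (u := u) hs
      rw [abs_of_pos hu.1] at h1
      have := neg_abs_le (a + s * u - a)
      rw [mem_Ioi]
      linarith [hf.ε_lt, hu.2]
    · rw [hx]
      refine ((((hsol.comp_ray hτ.le).1.hasDerivAt (Ici_mem_nhds hτ)).sub_const a).const_mul
        s).congr_deriv ?_
      linear_combination -(σ * s * radialField l c (ρ (t₀ + σ * τ))) * hθθ
  rw [tendsto_map'_iff]
  have := (hv.const_mul s).const_add a
  simp only [hx, mul_zero, add_zero] at this
  exact this

end Spiral

theorem theorem4p2 (l m : ℕ) (c : Fin l → ℝ) (a : ℝ) (hm : 1 ≤ m) (hml : m ≤ l)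
    (hcycle : IsLimitCycle l c a) (hmult : HasCycleMultiplicity l c a m) :
    -- near the cycle, on either side: through every point passes a spiral tending to the cycle,
    -- and every half-trajectory that stays near the cycle tends to it
    (∃ ε : ℝ, 0 < ε ∧ ∀ s : ℝ, (s = 1 ∨ s = -1) →
      (∀ ρ₀ φ₀ : ℝ, 0 < s * (ρ₀ - a) → s * (ρ₀ - a) < ε →
        ∃ (I : Set ℝ) (F : Filter ℝ) (ρ φ : ℝ → ℝ), IsSpiralTo l c a s I F ρ φ ∧
          (∃ t₀ ∈ I, ρ t₀ = ρ₀ ∧ φ t₀ = φ₀) ∧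
          ∀ t ∈ I, s * (ρ t - a) ≤ s * (ρ₀ - a)) ∧
      (∀ (I : Set ℝ) (F : Filter ℝ) (ρ φ : ℝ → ℝ), IsTimeRay I F → IsSolutionOn l c I ρ φ →
        (∀ t ∈ I, 0 < s * (ρ t - a) ∧ s * (ρ t - a) < ε) → IsSpiralTo l c a s I F ρ φ)) ∧
    -- exponential case
    (m = 1 → ∃ β : ℝ, β ≠ 0 ∧
      ∀ (s : ℝ) (I : Set ℝ) (F : Filter ℝ) (ρ φ : ℝ → ℝ), IsSpiralTo l c a s I F ρ φ →
        Comparable F (fun t => s * (ρ t - a)) (fun t => Real.exp (-β * φ t))) ∧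
    -- power case
    (1 < m →
      ∀ (s : ℝ) (I : Set ℝ) (F : Filter ℝ) (ρ φ : ℝ → ℝ), IsSpiralTo l c a s I F ρ φ →
        Comparable F (fun t => s * (ρ t - a)) (fun t => |φ t| ^ (-1 / ((m : ℝ) - 1)))) ∧
    -- box dimension
    (∀ (s : ℝ) (I : Set ℝ) (F : Filter ℝ) (ρ φ : ℝ → ℝ), IsSpiralTo l c a s I F ρ φ →
      HasBoxDim (orbitSet I ρ φ) (2 - 1 / (m : ℝ))) := by
  obtain ⟨ha, hfa⟩ := hcycle.pos_and_radialField_eq_zero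
  obtain ⟨g, ε, M, C, hf⟩ := exists_localFactor ha (analyticAt_radialField l c ha) hfa
    (analyticOrderAt_radialField ha hfa hmult)
  refine ⟨⟨ε, hf.ε_pos, fun s hs => ⟨fun ρ₀ φ₀ h0 h1 => ?_, fun I F ρ φ hray hsol hI =>
    hf.isSpiralTo hs hray hsol hI⟩⟩, ?_, fun h1m s I F ρ φ h => h.comparable_rpow h1m hf,
    fun s I F ρ φ h => h.hasBoxDim hm ha hf⟩
  · obtain ⟨I, F, ρ, φ, hray, hsol, hpt, hbd⟩ := hf.exists_halfTrajectory hs φ₀ h0 h1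
    exact ⟨I, F, ρ, φ, hf.isSpiralTo hs hray hsol fun t ht =>
      ⟨(hbd t ht).1, (hbd t ht).2.trans_lt h1⟩, hpt, fun t ht => (hbd t ht).2⟩
  · rintro rfl
    refine ⟨-g a, fun h0 => ?_, fun s I F ρ φ h => h.comparable_exp hf⟩
    have := hf.mul_pos a (by simpa using hf.ε_pos.le)
    rw [neg_eq_zero.1 h0, mul_zero] at this
    exact lt_irrefl 0 this
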